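/- Let $d\ge 2$ be an integer, let $\sigma$ be the standard surface measure on the unit sphere $\mathbb{S}^{d-1}\subset\mathbb{R}^d$, let $\omega_{d-2}=2\pi^{(d-1)/2}/\Gamma((d-1)/2)$ be the total surface measure of $\mathbb{S}^{d-2}\subset\mathbb{R}^{d-1}$ (so $\omega_0=2$), and for $f\in L^1(\mathbb{S}^{d-1},\sigma)$ put $$\widehat{f\sigma}(\xi)=\int_{\mathbb{S}^{d-1}}e^{-i\zeta\cdot\xi}f(\zeta)\,d\sigma(\zeta)\qquad(\xi\in\mathbb{R}^d).$$ Let $f_1,f_2\in L^1(\mathbb{S}^{d-1},\sigma)$ be complex-valued functions, neither of which vanishes $\sigma$-almost everywhere. Then $$\big\|\widehat{f_1\sigma}\,\widehat{f_2\sigma}\big\|_{L^2(\mathbb{R}^d)}^2\le(2\pi)^d\,2^{(2-d)/2}\,\omega_{d-2}\int_{(\mathbb{S}^{d-1})^2}\left[\frac{(1-\zeta_1\cdot\zeta_2)^{d-3}}{1+\zeta_1\cdot\zeta_2}\right]^{1/2}|f_1(\zeta_1)|^2\,|f_2(\zeta_2)|^2\,d\sigma(\zeta_1)\,d\sigma(\zeta_2),$$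 where both sides take values in $[0,\infty]$. If moreover $d\ge3$ and the right-hand side is finite, then equality holds if and only if there exist $c_1,c_2\in\mathbb{C}\setminus\{0\}$ and $\nu\in\mathbb{C}^d$ such that $$f_1(\zeta)=c_1e^{\nu\cdot\zeta}\quad\text{and}\quad f_2(\zeta)=c_2e^{\nu\cdot\zeta}\qquad\text{for }\sigma\text{-a.e. }\zeta\in\mathbb{S}^{d-1},$$ where $\nu\cdot\zeta=\sum_{i=1}^d\nu_i\zeta_i$. -/

import Mathlib

open MeasureTheory
open scoped ENNReal

/-- The unit sphere `𝕊^{d-1}` of `ℝ^d`. -/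
abbrev USphere (d : ℕ) : Type :=
  Metric.sphere (0 : EuclideanSpace ℝ (Fin d)) 1

/-- The standard (not normalized) surface measure `σ = σ_{d-1}` on `𝕊^{d-1} ⊆ ℝ^d`. -/
noncomputable def surfaceMeasure (d : ℕ) : Measure (USphere d) :=
  (volume : Measure (EuclideanSpace ℝ (Fin d))).toSphere

/-- The total surface measure `ω_n` of the `n`-dimensional unit sphere `𝕊^n ⊆ ℝ^{n+1}`. -/
noncomputable def sphereArea (n : ℕ) : ℝ≥0∞ :=
  surfaceMeasure (n + 1) Set.univ

/-- The Fourier transform of the measure `f σ`: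
`ξ ↦ ∫ e^{-i ζ·ξ} f(ζ) dσ(ζ)`. -/
noncomputable def extensionFourier (d : ℕ) (f : USphere d → ℂ)
    (ξ : EuclideanSpace ℝ (Fin d)) : ℂ :=
  ∫ ζ : USphere d,
    Complex.exp (-Complex.I * ((inner ℝ (ζ : EuclideanSpace ℝ (Fin d)) ξ : ℝ) : ℂ)) * f ζ
    ∂(surfaceMeasure d)

/-- The kernel `[(1 - ζ₁·ζ₂)^{d-3} / (1 + ζ₁·ζ₂)]^{1/2}`, with values in `[0, ∞]`
(it is `∞` where a denominator vanishes). -/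
noncomputable def weightKernel (d : ℕ) (ζ₁ ζ₂ : USphere d) : ℝ≥0∞ :=
  (ENNReal.ofReal (1 - inner ℝ (ζ₁ : EuclideanSpace ℝ (Fin d)) (ζ₂ : EuclideanSpace ℝ (Fin d)))
      ^ ((d : ℝ) - 3) /
    ENNReal.ofReal (1 + inner ℝ (ζ₁ : EuclideanSpace ℝ (Fin d)) (ζ₂ : EuclideanSpace ℝ (Fin d))))
    ^ (1 / 2 : ℝ)

/-- The squared norm `‖(f₁σ)^ (f₂σ)^‖²` in `L²(ℝ^d)`, possibly `∞`. -/
noncomputable def bilinearExtensionNormSq (d : ℕ) (f₁ f₂ : USphere d → ℂ) : ℝ≥0∞ :=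
  eLpNorm (fun ξ : EuclideanSpace ℝ (Fin d) => extensionFourier d f₁ ξ * extensionFourier d f₂ ξ)
    2 volume ^ 2

/-- The weighted side
`(2π)^d 2^{(2-d)/2} ω_{d-2} ∫∫ [(1 - ζ₁·ζ₂)^{d-3}/(1 + ζ₁·ζ₂)]^{1/2} |f₁(ζ₁)|² |f₂(ζ₂)|² dσ dσ`,
possibly `∞`; it is used for `d ≥ 2` only. -/
noncomputable def weightedSide (d : ℕ) (f₁ f₂ : USphere d → ℂ) : ℝ≥0∞ :=
  ENNReal.ofReal ((2 * Real.pi) ^ d * (2 : ℝ) ^ ((2 - (d : ℝ)) / 2)) * sphereArea (d - 2) *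
    ∫⁻ p : USphere d × USphere d,
      weightKernel d p.1 p.2 * ‖f₁ p.1‖ₑ ^ 2 * ‖f₂ p.2‖ₑ ^ 2
      ∂((surfaceMeasure d).prod (surfaceMeasure d))

/-!
Write `s (ζ₁, ζ₂) = ζ₁ + ζ₂`. The product of the two Fourier transforms is the Fourier transform of
the image under `s` of the measure `f₁ ⊗ f₂ · σ × σ`, and the image of `σ × σ` itself has an
explicit density whose value at `ζ₁ + ζ₂` is a multiple of the weight. By Plancherel and
Cauchy–Schwarz in the fibres of `s` this gives the inequality, with equality exactly when `f₁ ⊗ f₂`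
is a function of `ζ₁ + ζ₂` almost everywhere.

In that case `f₁ ⊗ f₂` is orthogonal to every function whose image under `s` vanishes. Let `G f μ`
be the gradient at `μ` of the Fourier–Laplace transform `∫ f e^μ dσ`. Rotation invariance provides
such functions, and testing on them shows that `ν - μ`, `G f₁ μ` and `G f₂ ν` are always linearly
dependent. As `f₁` and `f₂` are proportional by symmetry, any two of the lines `μ + ℂ · G f₁ μ` are
coplanar; in dimension at least three these lines are not all parallel to one plane, so they pass
through a common point `O`. Then the Fourier transform of `f₁ e^O` has a radial gradient, so
`f₁ e^O` is constant.
-/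

section Plancherel

open FourierTransform SchwartzMap

variable {V : Type*} [NormedAddCommGroup V] [InnerProductSpace ℝ V]

/-- A smooth compactly supported real function, as a complex-valued Schwartz function. -/
noncomputable def ofRealSchwartz {g : V → ℝ} (hg : ContDiff ℝ (⊤ : ℕ∞) g)
    (hgs : HasCompactSupport g) : 𝓢(V, ℂ) :=
  (hgs.comp_left (g := fun r : ℝ => (r : ℂ)) Complex.ofReal_zero).toSchwartzMap
    (Complex.ofRealCLM.contDiff.comp hg)

@[simp]
theorem ofRealSchwartz_apply {g : V → ℝ} (hg : ContDiff ℝ (⊤ : ℕ∞) g)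
    (hgs : HasCompactSupport g) (x : V) : ofRealSchwartz hg hgs x = g x :=
  rfl

variable [FiniteDimensional ℝ V] [MeasurableSpace V] [BorelSpace V]

theorem integral_fourier_smul_eq (φ : 𝓢(V, ℂ)) {μ : Measure V} [SigmaFinite μ] {F : V → ℂ}
    (hF : Integrable F μ) :
    ∫ x, 𝓕 φ x • F x ∂μ =
      ∫ ξ, φ ξ • VectorFourier.fourierIntegral Real.fourierChar μ (innerₗ V) F ξ := by
  have hflip := VectorFourier.integral_fourierIntegral_smul_eq_flip (e := Real.fourierChar)
    (L := innerₗ V) (μ := volume) (ν := μ) Real.continuous_fourierChar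
    (by exact continuous_inner) φ.integrable hF
  rwa [flip_innerₗ] at hflip

theorem Lp_fourier_toLp_ae_eq {f : V → ℂ} (h₁ : Integrable f) (h₂ : MemLp f 2) :
    ((𝓕 (h₂.toLp f) : Lp ℂ 2 (volume : Measure V)) : V → ℂ) =ᵐ[volume] 𝓕 f := by
  have hcont : Continuous (𝓕 f) :=
    VectorFourier.fourierIntegral_continuous Real.continuous_fourierChar
      (by exact continuous_inner) h₁
  refine ae_eq_of_integral_contDiff_smul_eq
    ((Lp.memLp _).locallyIntegrable one_le_two) hcont.locallyIntegrable fun g hg hgs => ?_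
  have hduality := congrArg (fun T => T (ofRealSchwartz hg hgs))
    (Lp.fourier_toTemperedDistribution_eq (h₂.toLp f))
  simp only [TemperedDistribution.fourier_apply, Lp.toTemperedDistribution_apply] at hduality
  calc ∫ x, g x • (𝓕 (h₂.toLp f) : Lp ℂ 2 (volume : Measure V)) x
      = ∫ x, 𝓕 (ofRealSchwartz hg hgs) x • h₂.toLp f x := by rw [hduality]; simp
    _ = ∫ x, 𝓕 (ofRealSchwartz hg hgs) x • f x :=
        integral_congr_ae <| h₂.coeFn_toLp.mono fun x hx => by simp only [hx]
    _ = ∫ x, ofRealSchwartz hg hgs x • 𝓕 f x := integral_fourier_smul_eq _ h₁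
    _ = ∫ x, g x • 𝓕 f x := by simp

theorem eLpNorm_fourier {f : V → ℂ} (h₁ : Integrable f) (h₂ : MemLp f 2) :
    eLpNorm (𝓕 f) 2 volume = eLpNorm f 2 volume := by
  rw [← eLpNorm_congr_ae (Lp_fourier_toLp_ae_eq h₁ h₂), ← eLpNorm_congr_ae h₂.coeFn_toLp]
  have hnorm := Lp.norm_fourier_eq (h₂.toLp f)
  rw [Lp.norm_def, Lp.norm_def] at hnorm
  exact (ENNReal.toReal_eq_toReal_iff' (Lp.eLpNorm_ne_top _) (Lp.eLpNorm_ne_top _)).1 hnorm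

end Plancherel

section PushFourier

open FourierTransform SchwartzMap

variable {Ω : Type*} [MeasurableSpace Ω] {W : Measure Ω}
  {V : Type*} [NormedAddCommGroup V] [InnerProductSpace ℝ V]

/-- The Fourier transform of the push-forward under `s` of the complex measure `P W`, normalised
as `extensionFourier`. -/
noncomputable def pushFourier (W : Measure Ω) (s : Ω → V) (P : Ω → ℂ) (ξ : V) : ℂ :=
  ∫ ω, Complex.exp (-Complex.I * ((inner ℝ (s ω) ξ : ℝ) : ℂ)) * P ω ∂W

theorem norm_exp_neg_I_mul (t : ℝ) : ‖Complex.exp (-Complex.I * (t : ℂ))‖ = 1 := by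
  simpa using Complex.norm_exp_I_mul_ofReal (-t)

theorem vectorFourier_eq_pushFourier [MeasurableSpace V] (μ : Measure V) (F : V → ℂ) (ξ : V) :
    VectorFourier.fourierIntegral Real.fourierChar μ (innerₗ V) F ξ =
      pushFourier μ id F ((2 * Real.pi) • ξ) := by
  refine integral_congr_ae (ae_of_all _ fun x => ?_)
  simp only [Circle.smul_def, Real.fourierChar_apply, innerₗ_apply_apply, smul_eq_mul, id,
    inner_smul_right]
  push_cast
  ring_nf

theorem pushFourier_id_one_eq_charFun [MeasurableSpace V] (μ : Measure V) (ξ : V) :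
    pushFourier μ id 1 (-ξ) = charFun μ ξ := by
  simp [pushFourier, charFun_apply, mul_comm]

variable [FiniteDimensional ℝ V] [MeasurableSpace V] [BorelSpace V] {s : Ω → V} {P : Ω → ℂ}

theorem integrable_exp_mul (hs : Measurable s) (hP : Integrable P W) (ξ : V) :
    Integrable (fun ω => Complex.exp (-Complex.I * ((inner ℝ (s ω) ξ : ℝ) : ℂ)) * P ω) W :=
  hP.bdd_mul (c := 1) (by fun_prop) (ae_of_all _ fun _ => (norm_exp_neg_I_mul _).le)

theorem pushFourier_condExp [IsFiniteMeasure W] (hs : Measurable s) (hP : Integrable P W) :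
    pushFourier W s (W[P | MeasurableSpace.comap s inferInstance]) = pushFourier W s P := by
  funext ξ
  have hexp : StronglyMeasurable[MeasurableSpace.comap s inferInstance]
      fun ω => Complex.exp (-Complex.I * ((inner ℝ (s ω) ξ : ℝ) : ℂ)) :=
    ((by fun_prop : Measurable fun x : V =>
      Complex.exp (-Complex.I * ((inner ℝ x ξ : ℝ) : ℂ))).comp
        (comap_measurable s)).stronglyMeasurable
  have hpull := condExp_bilin_of_stronglyMeasurable_left (ContinuousLinearMap.mul ℝ ℂ) hexp
    (integrable_exp_mul hs hP ξ) hP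
  exact (integral_congr_ae hpull.symm).trans (integral_condExp hs.comap_le)

theorem pushFourier_comp (hs : Measurable s) {F : V → ℂ} (hF : StronglyMeasurable F) :
    pushFourier W s (F ∘ s) = pushFourier (W.map s) id F := by
  have := hF.measurable
  funext ξ
  exact (integral_map (f := fun x : V =>
    Complex.exp (-Complex.I * ((inner ℝ x ξ : ℝ) : ℂ)) * F x) hs.aemeasurable (by fun_prop)).symm

theorem ae_eq_zero_of_pushFourier_id_eq_zero {μ : Measure V} [IsFiniteMeasure μ] {F : V → ℂ}
    (hF : Integrable F μ) (h0 : pushFourier μ id F = 0) : F =ᵐ[μ] 0 := by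
  refine ae_eq_zero_of_integral_contDiff_smul_eq_zero hF.locallyIntegrable fun g hg hgs => ?_
  calc ∫ x, g x • F x ∂μ
      = ∫ x, 𝓕 (𝓕⁻ (ofRealSchwartz hg hgs)) x • F x ∂μ := by
        simp [FourierTransform.fourier_fourierInv_eq]
    _ = 0 := by
        rw [integral_fourier_smul_eq _ hF]
        simp [vectorFourier_eq_pushFourier, h0]

theorem condExp_comap_ae_eq_zero [IsFiniteMeasure W] (hs : Measurable s) (hP : Integrable P W)
    (h0 : pushFourier W s P = 0) : W[P | MeasurableSpace.comap s inferInstance] =ᵐ[W] 0 := by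
  obtain ⟨F, hF, hFK⟩ := (stronglyMeasurable_condExp (μ := W)
    (m := MeasurableSpace.comap s inferInstance) (f := P)).exists_eq_measurable_comp
  have hFint : Integrable F (W.map s) :=
    (integrable_map_measure hF.aestronglyMeasurable hs.aemeasurable).2
      (hFK ▸ integrable_condExp)
  have hF0 : pushFourier (W.map s) id F = 0 := by
    rw [← pushFourier_comp hs hF, ← hFK, pushFourier_condExp hs hP, h0]
  rw [hFK]
  exact ae_eq_comp hs.aemeasurable (ae_eq_zero_of_pushFourier_id_eq_zero hFint hF0)

theorem ae_eq_zero_of_pushFourier_eq_zero [IsFiniteMeasure W] (hs : MeasurableEmbedding s)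
    (hP : Integrable P W) (h0 : pushFourier W s P = 0) : P =ᵐ[W] 0 := by
  have hcond := condExp_comap_ae_eq_zero hs.measurable hP h0
  rw [hs.comap_eq] at hcond
  exact (condExp_of_aestronglyMeasurable' le_rfl hP.1 hP).symm.trans hcond

theorem integral_mul_eq_zero_of_pushFourier_eq_zero [IsFiniteMeasure W] (hs : Measurable s)
    (hP : Integrable P W) (h0 : pushFourier W s P = 0) {K : Ω → ℂ}
    (hK : AEStronglyMeasurable[MeasurableSpace.comap s inferInstance] K W)
    (hKP : Integrable (fun ω => K ω * P ω) W) : ∫ ω, K ω * P ω ∂W = 0 := by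
  have hpull := condExp_bilin_of_aestronglyMeasurable_left (ContinuousLinearMap.mul ℝ ℂ) hK hKP hP
  calc ∫ ω, K ω * P ω ∂W
      = ∫ ω, K ω * (W[P | MeasurableSpace.comap s inferInstance]) ω ∂W := by
        rw [← integral_condExp hs.comap_le]
        exact integral_congr_ae hpull
    _ = 0 := integral_eq_zero_of_ae <|
        (condExp_comap_ae_eq_zero hs hP h0).mono fun ω hω => by simp [hω]

end PushFourier

section WeightedBound

open FourierTransform
open scoped NNReal

theorem condExp_ae_eq_of_eLpNorm_two_eq {Ω : Type*} {m m0 : MeasurableSpace Ω} {W : Measure Ω}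
    [IsFiniteMeasure W] (hm : m ≤ m0) {Q : Ω → ℂ} (hQ : MemLp Q 2 W)
    (h : eLpNorm (W[Q | m]) 2 W = eLpNorm Q 2 W) : W[Q | m] =ᵐ[W] Q := by
  have : Fact (m ≤ m0) := ⟨hm⟩
  have hcond := hQ.condExpL2_ae_eq_condExp (𝕜 := ℂ) hm
  rw [← eLpNorm_congr_ae hcond, ← eLpNorm_congr_ae hQ.coeFn_toLp] at h
  have hnorm : ‖(lpMeas ℂ ℂ m 2 W).starProjection (hQ.toLp Q)‖ = ‖hQ.toLp Q‖ := by
    rw [Lp.norm_def, Lp.norm_def]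
    exact congrArg ENNReal.toReal h
  have hfix : (condExpL2 ℂ ℂ hm (hQ.toLp Q) : Lp ℂ 2 W) = hQ.toLp Q :=
    Submodule.starProjection_eq_self_iff.2 ((Submodule.mem_iff_norm_starProjection _ _).2 hnorm)
  rw [hfix] at hcond
  exact hcond.symm.trans hQ.coeFn_toLp

variable {Ω : Type*} [MeasurableSpace Ω] {W : Measure Ω}

local notation "ℱ" s:max => MeasurableSpace.comap s inferInstance

theorem eLpNorm_two_sq {E : Type*} [NormedAddCommGroup E] (f : Ω → E) :
    eLpNorm f 2 W ^ 2 = ∫⁻ ω, ‖f ω‖ₑ ^ 2 ∂W := by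
  simpa using eLpNorm_nnreal_pow_eq_lintegral (f := f) (μ := W) (p := 2) two_ne_zero

theorem eLpNorm_sqrt_smul_sq (w : Ω → ℝ≥0) (Q : Ω → ℂ) :
    eLpNorm (fun ω => √(w ω : ℝ) • Q ω) 2 W ^ 2 = ∫⁻ ω, w ω * ‖Q ω‖ₑ ^ 2 ∂W := by
  rw [eLpNorm_two_sq]
  refine lintegral_congr fun ω => ?_
  rw [enorm_smul, mul_pow, Real.enorm_of_nonneg (Real.sqrt_nonneg _),
    ← ENNReal.ofReal_pow (Real.sqrt_nonneg _), Real.sq_sqrt (NNReal.coe_nonneg _),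
    ENNReal.ofReal_coe_nnreal]

variable {V : Type*} [MeasurableSpace V] {s : Ω → V} {h : V → ℝ≥0} {P : Ω → ℂ}

theorem memLp_sqrt_smul (hs : Measurable s) (hh : Measurable h)
    (hP : AEStronglyMeasurable P W) (hfin : ∫⁻ ω, h (s ω) * ‖P ω‖ₑ ^ 2 ∂W < ∞) :
    MemLp (fun ω => √(h (s ω) : ℝ) • P ω) 2 W := by
  have hsqrt : Measurable fun ω => √(h (s ω) : ℝ) := by fun_prop
  refine ⟨hsqrt.aestronglyMeasurable.smul hP, ?_⟩
  rw [← eLpNorm_sqrt_smul_sq fun ω => h (s ω)] at hfin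
  exact (ENNReal.pow_lt_top_iff.1 hfin).resolve_right two_ne_zero

theorem condExp_sqrt_smul [IsFiniteMeasure W] (hh : Measurable h) (hP : Integrable P W)
    (hQ : MemLp (fun ω => √(h (s ω) : ℝ) • P ω) 2 W) :
    W[fun ω => √(h (s ω) : ℝ) • P ω | ℱ s] =ᵐ[W]
      fun ω => √(h (s ω) : ℝ) • W[P | ℱ s] ω :=
  condExp_smul_of_aestronglyMeasurable_left
    ((by fun_prop : Measurable fun x : V => √(h x : ℝ)).comp
      (comap_measurable s)).aestronglyMeasurable (hQ.integrable one_le_two) hP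

variable [NormedAddCommGroup V] [InnerProductSpace ℝ V] [FiniteDimensional ℝ V] [BorelSpace V]

theorem eLpNorm_comp_inv_smul_two_sq (g : V → ℂ) {r : ℝ} (hr : 0 < r) :
    eLpNorm (fun ξ => g (r⁻¹ • ξ)) 2 volume ^ 2 =
      ENNReal.ofReal (r ^ Module.finrank ℝ V) * eLpNorm g 2 volume ^ 2 := by
  have hr' : r⁻¹ ≠ 0 := inv_ne_zero hr.ne'
  have hemb := (Homeomorph.smulOfNeZero (α := V) r⁻¹ hr').measurableEmbedding
  have hmap := hemb.lintegral_map (μ := volume) fun x => ‖g x‖ₑ ^ 2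
  simp only [Homeomorph.smulOfNeZero_apply] at hmap
  rw [eLpNorm_two_sq, eLpNorm_two_sq, ← hmap]
  change ∫⁻ a, ‖g a‖ₑ ^ 2 ∂(Measure.map (r⁻¹ • ·) volume) = _
  rw [Measure.map_addHaar_smul volume hr', lintegral_smul_measure, smul_eq_mul, inv_pow, inv_inv,
    abs_of_pos (by positivity)]

theorem pushFourier_withDensity_eq_fourier (hh : Measurable h) (F : V → ℂ) (ξ : V) :
    pushFourier (volume.withDensity fun x => h x) id F ξ =
      𝓕 (fun x => h x • F x) ((2 * Real.pi)⁻¹ • ξ) := by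
  rw [pushFourier, integral_withDensity_eq_integral_smul hh, Real.fourier_eq']
  refine integral_congr_ae (ae_of_all _ fun x => ?_)
  have hphase : -2 * Real.pi * inner ℝ x ((2 * Real.pi)⁻¹ • ξ) = -inner ℝ x ξ := by
    rw [inner_smul_right]
    field_simp
  simp only [hphase, NNReal.smul_def, smul_eq_mul, id, Complex.real_smul]
  push_cast
  ring_nf

theorem eLpNorm_smul_two_sq_eq_lintegral (hs : Measurable s) (hh : Measurable h)
    (hW : W.map s = volume.withDensity fun x => (h x : ℝ≥0∞)) {F : V → ℂ} (hF : Measurable F) :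
    eLpNorm (fun x => h x • F x) 2 volume ^ 2 = ∫⁻ ω, h (s ω) * ‖F (s ω)‖ₑ ^ 2 ∂W := by
  have hmap := lintegral_map (μ := W) (f := fun x => h x * ‖F x‖ₑ ^ 2) (by fun_prop) hs
  rw [← hmap, hW, lintegral_withDensity_eq_lintegral_mul _ (by fun_prop) (by fun_prop),
    eLpNorm_two_sq]
  refine lintegral_congr fun x => ?_
  simp only [NNReal.smul_def, enorm_smul, Pi.mul_apply,
    Real.enorm_of_nonneg (NNReal.coe_nonneg _),
    ENNReal.ofReal_coe_nnreal]
  ring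

theorem ae_pos_comp (hs : Measurable s) (hh : Measurable h)
    (hW : W.map s = volume.withDensity fun x => (h x : ℝ≥0∞)) : ∀ᵐ ω ∂W, 0 < h (s ω) := by
  refine ae_of_ae_map hs.aemeasurable (p := fun x => 0 < h x) ?_
  rw [hW, ae_withDensity_iff (by fun_prop)]
  exact ae_of_all _ fun x hx => by simpa [pos_iff_ne_zero] using hx

theorem eLpNorm_pushFourier_two_sq [IsFiniteMeasure W] (hs : Measurable s) (hh : Measurable h)
    (hW : W.map s = volume.withDensity fun x => (h x : ℝ≥0∞)) (hP : Integrable P W)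
    (hQ : MemLp (fun ω => √(h (s ω) : ℝ) • P ω) 2 W) :
    eLpNorm (pushFourier W s P) 2 volume ^ 2 =
      ENNReal.ofReal ((2 * Real.pi) ^ Module.finrank ℝ V) *
        eLpNorm (W[fun ω => √(h (s ω) : ℝ) • P ω | ℱ s]) 2 W ^ 2 := by
  obtain ⟨F, hF, hFP⟩ := (stronglyMeasurable_condExp (μ := W)
    (m := ℱ s) (f := P)).exists_eq_measurable_comp
  have hnorm : eLpNorm (fun x => h x • F x) 2 volume ^ 2 =
      eLpNorm (W[fun ω => √(h (s ω) : ℝ) • P ω | ℱ s]) 2 W ^ 2 := by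
    rw [eLpNorm_smul_two_sq_eq_lintegral hs hh hW hF.measurable,
      eLpNorm_congr_ae (condExp_sqrt_smul hh hP hQ), eLpNorm_sqrt_smul_sq (fun ω => h (s ω)), hFP]
    rfl
  have := hF.measurable
  have hmem : MemLp (fun x => h x • F x) 2 (volume : Measure V) := by
    refine ⟨by fun_prop, (ENNReal.pow_lt_top_iff.1 ?_).resolve_right two_ne_zero⟩
    rw [hnorm]
    exact ENNReal.pow_lt_top (hQ.condExp one_le_two).2
  have hint : Integrable (fun x => h x • F x) (volume : Measure V) := by
    rw [← integrable_withDensity_iff_integrable_smul hh, ← hW,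
      integrable_map_measure hF.aestronglyMeasurable hs.aemeasurable, ← hFP]
    exact integrable_condExp
  rw [← hnorm, ← eLpNorm_fourier hint hmem, ← eLpNorm_comp_inv_smul_two_sq _ Real.two_pi_pos,
    ← pushFourier_condExp hs hP, hFP, pushFourier_comp hs hF, hW]
  simp only [← pushFourier_withDensity_eq_fourier hh]

theorem eLpNorm_pushFourier_two_sq_le [IsFiniteMeasure W] (hs : Measurable s) (hh : Measurable h)
    (hW : W.map s = volume.withDensity fun x => (h x : ℝ≥0∞)) (hP : Integrable P W) :
    eLpNorm (pushFourier W s P) 2 volume ^ 2 ≤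
      ENNReal.ofReal ((2 * Real.pi) ^ Module.finrank ℝ V) * ∫⁻ ω, h (s ω) * ‖P ω‖ₑ ^ 2 ∂W := by
  rcases eq_or_ne (∫⁻ ω, h (s ω) * ‖P ω‖ₑ ^ 2 ∂W) ∞ with htop | hfin
  · rw [htop, ENNReal.mul_top (ENNReal.ofReal_pos.2 (by positivity)).ne']
    exact le_top
  · have hQ := memLp_sqrt_smul hs hh hP.1 hfin.lt_top
    rw [eLpNorm_pushFourier_two_sq hs hh hW hP hQ, ← eLpNorm_sqrt_smul_sq fun ω => h (s ω)]
    gcongr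
    exact eLpNorm_condExp_le_eLpNorm _ one_le_two

/-- The bound is Plancherel followed by a conditional expectation, which preserves the norm exactly
on the functions of `s`. -/
theorem eLpNorm_pushFourier_two_sq_eq_iff [IsFiniteMeasure W] (hs : Measurable s)
    (hh : Measurable h) (hW : W.map s = volume.withDensity fun x => (h x : ℝ≥0∞))
    (hP : Integrable P W) (hfin : ∫⁻ ω, h (s ω) * ‖P ω‖ₑ ^ 2 ∂W < ∞) :
    eLpNorm (pushFourier W s P) 2 volume ^ 2 =
      ENNReal.ofReal ((2 * Real.pi) ^ Module.finrank ℝ V) * ∫⁻ ω, h (s ω) * ‖P ω‖ₑ ^ 2 ∂W ↔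
      AEStronglyMeasurable[ℱ s] P W := by
  have hQ := memLp_sqrt_smul hs hh hP.1 hfin
  have hcond := condExp_sqrt_smul hh hP hQ
  have hconst : ENNReal.ofReal ((2 * Real.pi) ^ Module.finrank ℝ V) ≠ 0 :=
    (ENNReal.ofReal_pos.2 (by positivity)).ne'
  rw [eLpNorm_pushFourier_two_sq hs hh hW hP hQ, ← eLpNorm_sqrt_smul_sq fun ω => h (s ω),
    ENNReal.mul_right_inj hconst ENNReal.ofReal_ne_top,
    (ENNReal.pow_right_strictMono two_ne_zero).injective.eq_iff]
  refine ⟨fun heq => ?_, fun hPs => ?_⟩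
  · refine (stronglyMeasurable_condExp (μ := W) (f := P)).aestronglyMeasurable.congr ?_
    filter_upwards [condExp_ae_eq_of_eLpNorm_two_eq hs.comap_le hQ heq, hcond,
      ae_pos_comp hs hh hW] with ω hfix hpull hpos
    exact smul_right_injective ℂ (Real.sqrt_pos.2 (NNReal.coe_pos.2 hpos)).ne'
      (hpull.symm.trans hfix)
  · refine eLpNorm_congr_ae (hcond.trans ?_)
    filter_upwards [condExp_of_aestronglyMeasurable' hs.comap_le hPs hP] with ω hω
    rw [hω]

end WeightedBound

section PolarCoordinates

variable {V : Type*} [NormedAddCommGroup V] [NormedSpace ℝ V] [FiniteDimensional ℝ V]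
  [Nontrivial V] [MeasurableSpace V] [BorelSpace V] (μ : Measure V) [μ.IsAddHaarMeasure]

theorem lintegral_eq_lintegral_toSphere {f : V → ℝ≥0∞} (hf : Measurable f) :
    ∫⁻ x, f x ∂μ = ∫⁻ ζ, ∫⁻ r in Set.Ioi (0 : ℝ),
      ENNReal.ofReal (r ^ (Module.finrank ℝ V - 1)) * f (r • (ζ : V)) ∂volume ∂μ.toSphere := by
  have hpolar := μ.measurePreserving_homeomorphUnitSphereProd.lintegral_comp_emb
    (Homeomorph.measurableEmbedding _)
    (fun p => f (((homeomorphUnitSphereProd V).symm p : ({0}ᶜ : Set V)) : V))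
  simp only [Homeomorph.symm_apply_apply] at hpolar
  conv_lhs => rw [← restrict_compl_singleton (μ := μ) (0 : V)]
  rw [← lintegral_subtype_comap (measurableSet_singleton _).compl, hpolar,
    lintegral_prod _ (by fun_prop)]
  refine lintegral_congr fun ζ => ?_
  simp only [homeomorphUnitSphereProd_symm_apply_coe, Measure.volumeIoiPow]
  rw [lintegral_withDensity_eq_lintegral_mul _ (by fun_prop) (by fun_prop)]
  exact lintegral_subtype_comap measurableSet_Ioi
    (fun r : ℝ => ENNReal.ofReal (r ^ (Module.finrank ℝ V - 1)) * f (r • (ζ : V)))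

theorem lintegral_fun_norm_toSphere {f : ℝ → ℝ≥0∞} (hf : Measurable f) :
    ∫⁻ x, f ‖x‖ ∂μ = μ.toSphere Set.univ * ∫⁻ r in Set.Ioi (0 : ℝ),
      ENNReal.ofReal (r ^ (Module.finrank ℝ V - 1)) * f r := by
  rw [lintegral_eq_lintegral_toSphere μ (f := fun x => f ‖x‖) (by fun_prop), mul_comm,
    ← lintegral_const]
  refine lintegral_congr fun ζ => setLIntegral_congr_fun measurableSet_Ioi fun r hr => ?_
  simp [norm_smul, abs_of_pos (Set.mem_Ioi.1 hr)]

end PolarCoordinates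

section SurfaceMeasure

variable {V : Type*} [NormedAddCommGroup V] [InnerProductSpace ℝ V]

local notation "𝕊" => Metric.sphere (0 : V) 1

/-- The action of a linear isometry on the unit sphere. -/
noncomputable def sphereHomeomorph (R : V ≃ₗᵢ[ℝ] V) : 𝕊 ≃ₜ 𝕊 :=
  R.toHomeomorph.subtype fun x => by simp

@[simp]
theorem coe_sphereHomeomorph (R : V ≃ₗᵢ[ℝ] V) (ζ : 𝕊) : (sphereHomeomorph R ζ : V) = R ζ :=
  rfl

theorem exists_linearIsometryEquiv_apply_eq {x y : V} (h : ‖x‖ = ‖y‖) :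
    ∃ R : V ≃ₗᵢ[ℝ] V, R x = y :=
  ⟨_, Submodule.reflection_sub h⟩

open Pointwise in
theorem Ioo_smul_image_preimage_sphereHomeomorph (R : V ≃ₗᵢ[ℝ] V) (A : Set 𝕊) :
    Set.Ioo (0 : ℝ) 1 • (((↑) : 𝕊 → V) '' (sphereHomeomorph R ⁻¹' A)) =
      R ⁻¹' (Set.Ioo (0 : ℝ) 1 • (((↑) : 𝕊 → V) '' A)) := by
  ext x
  simp only [Set.mem_smul, Set.mem_image, Set.mem_preimage]
  constructor
  · rintro ⟨r, hr, _, ⟨ζ, hζ, rfl⟩, rfl⟩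
    exact ⟨r, hr, _, ⟨_, hζ, rfl⟩, by simp⟩
  · rintro ⟨r, hr, _, ⟨ζ, hζ, rfl⟩, hx⟩
    refine ⟨r, hr, R.symm ζ, ⟨(sphereHomeomorph R).symm ζ, by simpa using hζ, rfl⟩, ?_⟩
    rw [← map_smul, hx, R.symm_apply_apply]

variable [FiniteDimensional ℝ V] [MeasurableSpace V] [BorelSpace V]

local notation "σ" => Measure.toSphere (volume : Measure V)

theorem measurePreserving_sphereHomeomorph (R : V ≃ₗᵢ[ℝ] V) :
    MeasurePreserving (sphereHomeomorph R) σ σ := by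
  have hR := (sphereHomeomorph R).measurable
  refine ⟨hR, Measure.ext fun A hA => ?_⟩
  rw [Measure.map_apply hR hA, Measure.toSphere_apply' _ hA, Measure.toSphere_apply' _ (hR hA),
    Ioo_smul_image_preimage_sphereHomeomorph,
    R.measurePreserving.measure_preimage_emb R.toHomeomorph.measurableEmbedding]

theorem integral_comp_sphereHomeomorph {E : Type*} [NormedAddCommGroup E] [NormedSpace ℝ E]
    (R : V ≃ₗᵢ[ℝ] V) (φ : 𝕊 → E) : ∫ ζ, φ (sphereHomeomorph R ζ) ∂σ = ∫ ζ, φ ζ ∂σ :=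
  (measurePreserving_sphereHomeomorph R).integral_comp
    (sphereHomeomorph R).measurableEmbedding φ

theorem pushFourier_toSphere_one_eq {x y : V} (h : ‖x‖ = ‖y‖) :
    pushFourier σ (↑) 1 x = pushFourier σ (↑) 1 y := by
  obtain ⟨R, rfl⟩ := exists_linearIsometryEquiv_apply_eq h
  unfold pushFourier
  rw [← integral_comp_sphereHomeomorph R fun ζ : 𝕊 =>
    Complex.exp (-Complex.I * ((inner ℝ (ζ : V) (R x) : ℝ) : ℂ)) * (1 : 𝕊 → ℂ) ζ]
  simp

theorem continuous_pushFourier_toSphere_one : Continuous (pushFourier σ ((↑) : 𝕊 → V) 1) := by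
  refine continuous_of_dominated (bound := fun _ => 1) (fun ξ => ?_)
    (fun ξ => ae_of_all _ fun ζ => ?_) (integrable_const _) (ae_of_all _ fun ζ => ?_)
  · simp only [Pi.one_apply, mul_one]
    fun_prop
  · simp [norm_exp_neg_I_mul, -neg_mul]
  · fun_prop

variable {Ω : Type*} [MeasurableSpace Ω] {W : Measure Ω} [SFinite W] {s : Ω → V} {P : Ω → ℂ}

/-- Average over `{‖η‖ = ‖ξ‖}` and exchange the integrals. -/
theorem smul_pushFourier_of_radial (hs : Measurable s) (hP : Integrable P W) {ξ : V}
    (hrad : ∀ η, ‖η‖ = ‖ξ‖ → pushFourier W s P η = pushFourier W s P ξ) :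
    (σ : Measure 𝕊).real Set.univ • pushFourier W s P ξ =
      ∫ ω, pushFourier σ (↑) 1 (‖ξ‖ • s ω) * P ω ∂W := by
  have hint : Integrable (fun p : 𝕊 × Ω =>
      Complex.exp (-Complex.I * ((inner ℝ (s p.2) (‖ξ‖ • (p.1 : V)) : ℝ) : ℂ)) * P p.2)
      (Measure.prod σ W) :=
    (hP.comp_snd σ).bdd_mul (c := 1) (by fun_prop) (ae_of_all _ fun _ => (norm_exp_neg_I_mul _).le)
  calc (σ : Measure 𝕊).real Set.univ • pushFourier W s P ξ
      = ∫ ζ : 𝕊, pushFourier W s P (‖ξ‖ • (ζ : V)) ∂σ := by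
        rw [← integral_const]
        exact integral_congr_ae <| ae_of_all _ fun ζ => (hrad _ (by simp [norm_smul])).symm
    _ = ∫ ω, ∫ ζ : 𝕊, Complex.exp (-Complex.I * ((inner ℝ (s ω) (‖ξ‖ • (ζ : V)) : ℝ) : ℂ)) * P ω
          ∂σ ∂W := integral_integral_swap hint
    _ = ∫ ω, pushFourier σ (↑) 1 (‖ξ‖ • s ω) * P ω ∂W := by
        simp only [integral_mul_const, pushFourier, Pi.one_apply, mul_one, inner_smul_right,
          real_inner_comm (s _)]

theorem smul_pushFourier_of_rotationInvariant {μ : Measure V} [IsFiniteMeasure μ]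
    (hμ : ∀ R : V ≃ₗᵢ[ℝ] V, μ.map R = μ) (e : 𝕊) (ξ : V) :
    (σ : Measure 𝕊).real Set.univ • pushFourier μ id 1 ξ =
      ∫ t : ℝ, pushFourier σ (↑) 1 ((‖ξ‖ * t) • (e : V)) ∂(μ.map norm) := by
  have hrad (η : V) (h : ‖η‖ = ‖ξ‖) : pushFourier μ id 1 η = pushFourier μ id 1 ξ := by
    obtain ⟨R, rfl⟩ := exists_linearIsometryEquiv_apply_eq h.symm
    conv_lhs => rw [← hμ R]
    simp only [pushFourier, Pi.one_apply, mul_one]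
    rw [integral_map R.continuous.aemeasurable (by fun_prop)]
    simp
  have hcont := continuous_pushFourier_toSphere_one (V := V)
  rw [smul_pushFourier_of_radial measurable_id (P := 1) (integrable_const _) hrad,
    integral_map (by fun_prop) (by fun_prop)]
  refine integral_congr_ae (ae_of_all _ fun x => ?_)
  simpa using pushFourier_toSphere_one_eq (by simp [norm_smul])

variable [Nontrivial V]

theorem toSphere_real_univ_pos : 0 < (σ : Measure 𝕊).real Set.univ :=
  have : NeZero (σ : Measure 𝕊) := ⟨Measure.toSphere_ne_zero _⟩
  measureReal_univ_pos

theorem ae_eq_const_of_pushFourier_radial {P : 𝕊 → ℂ} (hP : Integrable P σ)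
    (hrad : ∀ ξ η : V, ‖η‖ = ‖ξ‖ → pushFourier σ (↑) P η = pushFourier σ (↑) P ξ) :
    ∃ c : ℂ, P =ᵐ[σ] fun _ => c := by
  have hmass := toSphere_real_univ_pos (V := V)
  set c : ℂ := ((σ : Measure 𝕊).real Set.univ)⁻¹ • ∫ ζ, P ζ ∂σ
  have hmul (ξ : V) : pushFourier σ (↑) P ξ = pushFourier σ (↑) 1 ξ * c := by
    have havg := smul_pushFourier_of_radial measurable_subtype_coe hP (hrad ξ)
    rw [integral_congr_ae (ae_of_all _ fun ζ : 𝕊 => congrArg (· * P ζ)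
      (pushFourier_toSphere_one_eq (x := ‖ξ‖ • (ζ : V)) (y := ξ) (by simp [norm_smul]))),
      integral_const_mul] at havg
    rw [mul_smul_comm, ← havg, inv_smul_smul₀ hmass.ne']
  have hzero : pushFourier σ ((↑) : 𝕊 → V) (P - fun _ => c) = 0 := by
    funext ξ
    have hsub := integral_sub (integrable_exp_mul measurable_subtype_coe hP ξ)
      (integrable_exp_mul measurable_subtype_coe (integrable_const c) ξ)
    have hmul := hmul ξ
    simp only [pushFourier, Pi.sub_apply, mul_sub, Pi.zero_apply] at *
    rw [hsub, hmul]
    simp [integral_mul_const]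
  have hae := ae_eq_zero_of_pushFourier_eq_zero
    (MeasurableEmbedding.subtype_coe Metric.isClosed_sphere.measurableSet)
    (hP.sub (integrable_const c)) hzero
  exact ⟨c, hae.mono fun ζ hζ => sub_eq_zero.1 hζ⟩

theorem ext_of_rotationInvariant {μ ν : Measure V} [IsFiniteMeasure μ] [IsFiniteMeasure ν]
    (hμ : ∀ R : V ≃ₗᵢ[ℝ] V, μ.map R = μ) (hν : ∀ R : V ≃ₗᵢ[ℝ] V, ν.map R = ν)
    (h : μ.map norm = ν.map norm) : μ = ν := by
  obtain ⟨e, he⟩ := (NormedSpace.sphere_nonempty (x := (0 : V)) (r := 1)).2 zero_le_one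
  refine Measure.ext_of_charFun (funext fun ξ => ?_)
  refine smul_right_injective ℂ (toSphere_real_univ_pos (V := V)).ne' ?_
  simp only [← pushFourier_id_one_eq_charFun, smul_pushFourier_of_rotationInvariant hμ ⟨e, he⟩,
    smul_pushFourier_of_rotationInvariant hν ⟨e, he⟩, h]

end SurfaceMeasure

section AxialCoordinate

local notation "𝔼" d => EuclideanSpace ℝ (Fin d)

theorem measurePreserving_toLp_cons (n : ℕ) :
    MeasurePreserving
      (fun p : ℝ × 𝔼 n => WithLp.toLp 2 (Fin.cons p.1 p.2.ofLp : Fin (n + 1) → ℝ)) := by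
  have hcomp := (PiLp.volume_preserving_toLp (Fin (n + 1))).comp
    ((volume_preserving_piFinSuccAbove (fun _ : Fin (n + 1) => ℝ) 0).symm.comp
      ((MeasurePreserving.id (volume : Measure ℝ)).prod (PiLp.volume_preserving_ofLp (Fin n))))
  convert hcomp using 1
  · funext p
    simp [MeasurableEquiv.piFinSuccAbove, Fin.insertNthEquiv]
  · rfl

theorem lintegral_apply_zero_norm {n : ℕ} {g : ℝ → ℝ → ℝ≥0∞}
    (hg : Measurable (Function.uncurry g)) :
    ∫⁻ x : 𝔼 (n + 1), g (x 0) ‖x‖ = ∫⁻ t : ℝ, ∫⁻ y : 𝔼 n, g t (√(t ^ 2 + ‖y‖ ^ 2)) := by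
  have hmeas : Measurable fun x : 𝔼 (n + 1) => g (x 0) ‖x‖ :=
    hg.comp (by fun_prop : Measurable fun x : 𝔼 (n + 1) => (x 0, ‖x‖))
  have hnorm (p : ℝ × 𝔼 n) : ‖WithLp.toLp 2 (Fin.cons p.1 p.2.ofLp : Fin (n + 1) → ℝ)‖ =
      √(p.1 ^ 2 + ‖p.2‖ ^ 2) := by
    simp [EuclideanSpace.norm_eq, Fin.sum_univ_succ, Real.sq_sqrt, Finset.sum_nonneg, sq_nonneg]
  rw [← (measurePreserving_toLp_cons n).lintegral_comp hmeas]
  simp only [hnorm, Fin.cons_zero]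
  exact lintegral_prod _ (hg.comp (by fun_prop :
    Measurable fun p : ℝ × 𝔼 n => (p.1, √(p.1 ^ 2 + ‖p.2‖ ^ 2)))).aemeasurable

theorem lintegral_upperHalfPlane_polar {F : ℝ × ℝ → ℝ≥0∞} (hF : Measurable F) :
    ∫⁻ t, ∫⁻ ρ in Set.Ioi (0 : ℝ), F (t, ρ) =
      ∫⁻ r in Set.Ioi (0 : ℝ), ∫⁻ θ in Set.Ioo 0 Real.pi,
        ENNReal.ofReal r * F (r * Real.cos θ, r * Real.sin θ) := by
  have hU : MeasurableSet {p : ℝ × ℝ | 0 < p.2} := measurableSet_lt measurable_const measurable_snd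
  have hT : MeasurableSet (Set.Ioi (0 : ℝ) ×ˢ Set.Ioo 0 Real.pi) :=
    measurableSet_Ioi.prod measurableSet_Ioo
  have hupper (p : ℝ × ℝ) (hp : p ∈ polarCoord.target) :
      ENNReal.ofReal p.1 • {p : ℝ × ℝ | 0 < p.2}.indicator F (polarCoord.symm p) =
        (Set.Ioi (0 : ℝ) ×ˢ Set.Ioo 0 Real.pi).indicator
          (fun p => ENNReal.ofReal p.1 * F (p.1 * Real.cos p.2, p.1 * Real.sin p.2)) p := by
    obtain ⟨r, θ⟩ := p
    obtain ⟨hr : 0 < r, hθ⟩ := hp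
    have hsin : 0 < r * Real.sin θ ↔ 0 < θ := by
      rw [mul_pos_iff_of_pos_left hr]
      refine ⟨fun h => ?_, fun h => Real.sin_pos_of_pos_of_lt_pi h hθ.2⟩
      by_contra! h0
      exact h.not_ge (Real.sin_nonpos_of_nonpos_of_neg_pi_le h0 hθ.1.le)
    by_cases h0 : 0 < θ <;>
      simp [polarCoord_symm_apply, hsin, h0, hr, hθ.2]
  calc ∫⁻ t, ∫⁻ ρ in Set.Ioi (0 : ℝ), F (t, ρ)
      = ∫⁻ p, {p : ℝ × ℝ | 0 < p.2}.indicator F p := by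
        rw [Measure.volume_eq_prod, lintegral_prod _ (hF.indicator hU).aemeasurable]
        exact lintegral_congr fun t => (lintegral_indicator measurableSet_Ioi _).symm
    _ = ∫⁻ p in Set.Ioi (0 : ℝ) ×ˢ Set.Ioo 0 Real.pi,
          ENNReal.ofReal p.1 * F (p.1 * Real.cos p.2, p.1 * Real.sin p.2) := by
        have hsub : Set.Ioi (0 : ℝ) ×ˢ Set.Ioo 0 Real.pi ⊆ polarCoord.target :=
          Set.prod_mono subset_rfl (Set.Ioo_subset_Ioo_left (by linarith [Real.pi_pos]))
        rw [← lintegral_comp_polarCoord_symm,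
          setLIntegral_congr_fun polarCoord.open_target.measurableSet hupper,
          setLIntegral_indicator hT, Set.inter_eq_left.2 hsub]
    _ = _ := by
        rw [Measure.volume_eq_prod, ← Measure.prod_restrict, lintegral_prod _ (by fun_prop)]

theorem lintegral_apply_zero_norm_polar {n : ℕ} {g : ℝ → ℝ → ℝ≥0∞}
    (hg : Measurable (Function.uncurry g)) :
    ∫⁻ x : 𝔼 (n + 2), g (x 0) ‖x‖ = sphereArea n * ∫⁻ r in Set.Ioi (0 : ℝ),
      ENNReal.ofReal (r ^ (n + 1)) *
        ∫⁻ θ in Set.Ioo 0 Real.pi, ENNReal.ofReal (Real.sin θ ^ n) * g (r * Real.cos θ) r := by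
  let F : ℝ × ℝ → ℝ≥0∞ := fun p => ENNReal.ofReal (p.2 ^ n) * g p.1 (√(p.1 ^ 2 + p.2 ^ 2))
  have hF : Measurable F := Measurable.mul (by fun_prop) (hg.comp (by fun_prop :
    Measurable fun p : ℝ × ℝ => (p.1, √(p.1 ^ 2 + p.2 ^ 2))))
  have hslice (t : ℝ) : ∫⁻ y : 𝔼 (n + 1), g t (√(t ^ 2 + ‖y‖ ^ 2)) =
      sphereArea n * ∫⁻ ρ in Set.Ioi (0 : ℝ), F (t, ρ) := by
    rw [lintegral_fun_norm_toSphere volume (f := fun ρ => g t (√(t ^ 2 + ρ ^ 2)))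
      (hg.comp (by fun_prop : Measurable fun ρ : ℝ => (t, √(t ^ 2 + ρ ^ 2))))]
    simp [sphereArea, surfaceMeasure, F]
  rw [lintegral_apply_zero_norm hg]
  simp only [hslice]
  rw [lintegral_const_mul _ hF.lintegral_prod_right', lintegral_upperHalfPlane_polar hF]
  congr 1
  refine setLIntegral_congr_fun measurableSet_Ioi fun r hr => ?_
  rw [← lintegral_const_mul' _ _ ENNReal.ofReal_ne_top]
  refine setLIntegral_congr_fun measurableSet_Ioo fun θ hθ => ?_
  have hr : 0 < r := hr
  have hrad : √((r * Real.cos θ) ^ 2 + (r * Real.sin θ) ^ 2) = r := by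
    rw [mul_pow, mul_pow, ← mul_add, Real.cos_sq_add_sin_sq, mul_one, Real.sqrt_sq hr.le]
  have : 0 ≤ Real.sin θ := Real.sin_nonneg_of_mem_Icc (Set.Ioo_subset_Icc_self hθ)
  simp only [F, hrad]
  rw [← mul_assoc, ← mul_assoc, ← ENNReal.ofReal_mul hr.le, ← ENNReal.ofReal_mul (by positivity)]
  ring_nf

theorem lintegral_Ioi_pow_mul_exp_neg (n : ℕ) :
    ∫⁻ r in Set.Ioi (0 : ℝ), ENNReal.ofReal (r ^ n) * ENNReal.ofReal (Real.exp (-r)) =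
      ENNReal.ofReal n.factorial := by
  rw [← Real.Gamma_nat_eq_factorial, Real.Gamma_eq_integral (by positivity),
    ofReal_integral_eq_lintegral_ofReal (Real.GammaIntegral_convergent (by positivity))
      ((ae_restrict_mem measurableSet_Ioi).mono fun r (hr : 0 < r) => by positivity)]
  refine setLIntegral_congr_fun measurableSet_Ioi fun r (hr : 0 < r) => ?_
  rw [add_sub_cancel_right, Real.rpow_natCast, ← ENNReal.ofReal_mul (by positivity), mul_comm]

/-- The law of `ζ ↦ ζ₀` is found by integrating `φ (x₀ / ‖x‖) e^{-‖x‖}` in two ways. -/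
theorem lintegral_apply_zero_surfaceMeasure {n : ℕ} {φ : ℝ → ℝ≥0∞} (hφ : Measurable φ) :
    ∫⁻ ζ : USphere (n + 2), φ ((ζ : 𝔼 (n + 2)) 0) ∂(surfaceMeasure (n + 2)) =
      sphereArea n * ∫⁻ θ in Set.Ioo 0 Real.pi,
        ENNReal.ofReal (Real.sin θ ^ n) * φ (Real.cos θ) := by
  set c : ℝ≥0∞ := ENNReal.ofReal (n + 1).factorial
  have hc0 : c ≠ 0 := by simp [c, Nat.factorial_ne_zero]
  have hsep (k : ℝ≥0∞) : ∫⁻ r in Set.Ioi (0 : ℝ), ENNReal.ofReal (r ^ (n + 1)) *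
      (k * ENNReal.ofReal (Real.exp (-r))) = c * k := by
    simp only [c, ← lintegral_Ioi_pow_mul_exp_neg, ← lintegral_mul_const k
      (by fun_prop : Measurable fun r : ℝ =>
        ENNReal.ofReal (r ^ (n + 1)) * ENNReal.ofReal (Real.exp (-r)))]
    simp only [mul_assoc, mul_comm k]
  have hpolar := lintegral_apply_zero_norm_polar (n := n)
    (g := fun t r => φ (t / r) * ENNReal.ofReal (Real.exp (-r))) (by fun_prop)
  rw [lintegral_eq_lintegral_toSphere volume (by fun_prop)] at hpolar
  have hleft (ζ : USphere (n + 2)) :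
      ∫⁻ r in Set.Ioi (0 : ℝ), ENNReal.ofReal (r ^ (n + 1)) *
        (φ ((r • (ζ : 𝔼 (n + 2))) 0 / ‖r • (ζ : 𝔼 (n + 2))‖) *
          ENNReal.ofReal (Real.exp (-‖r • (ζ : 𝔼 (n + 2))‖))) =
      c * φ ((ζ : 𝔼 (n + 2)) 0) := by
    rw [← hsep]
    refine setLIntegral_congr_fun measurableSet_Ioi fun r (hr : 0 < r) => ?_
    simp [norm_smul, abs_of_pos hr, hr.ne']
  have hright (r : ℝ) (hr : 0 < r) :
      ENNReal.ofReal (r ^ (n + 1)) * ∫⁻ θ in Set.Ioo 0 Real.pi, ENNReal.ofReal (Real.sin θ ^ n) *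
        (φ (r * Real.cos θ / r) * ENNReal.ofReal (Real.exp (-r))) =
      ENNReal.ofReal (r ^ (n + 1)) * ((∫⁻ θ in Set.Ioo 0 Real.pi,
        ENNReal.ofReal (Real.sin θ ^ n) * φ (Real.cos θ)) * ENNReal.ofReal (Real.exp (-r))) := by
    rw [← lintegral_mul_const _ (by fun_prop)]
    simp only [mul_div_cancel_left₀ _ hr.ne', mul_assoc]
  rw [setLIntegral_congr_fun measurableSet_Ioi hright, hsep] at hpolar
  simp only [finrank_euclideanSpace, Fintype.card_fin, Nat.add_succ_sub_one, hleft] at hpolar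
  rw [lintegral_const_mul' _ _ ENNReal.ofReal_ne_top, mul_left_comm] at hpolar
  exact (ENNReal.mul_right_inj hc0 ENNReal.ofReal_ne_top).1 hpolar

end AxialCoordinate

section SphereAdd

variable {V : Type*} [NormedAddCommGroup V] [InnerProductSpace ℝ V] [FiniteDimensional ℝ V]
  [MeasurableSpace V] [BorelSpace V]

local notation "𝕊" => Metric.sphere (0 : V) 1
local notation "σ" => Measure.toSphere (volume : Measure V)

/-- The sum of two points of the unit sphere; its law under `σ × σ` is `σ ∗ σ`. -/
def sphereAdd (p : 𝕊 × 𝕊) : V := (p.1 : V) + p.2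

theorem measurable_sphereAdd : Measurable (sphereAdd (V := V)) := by
  unfold sphereAdd
  fun_prop

theorem map_sphereAdd_rotationInvariant (R : V ≃ₗᵢ[ℝ] V) :
    (((σ).prod σ).map sphereAdd).map R = ((σ).prod σ).map (sphereAdd (V := V)) := by
  have hR := (measurePreserving_sphereHomeomorph R).prod (measurePreserving_sphereHomeomorph R)
  rw [Measure.map_map R.continuous.measurable measurable_sphereAdd]
  conv_rhs => rw [← hR.map_eq, Measure.map_map measurable_sphereAdd hR.measurable]
  congr 1
  funext p
  simp [sphereAdd]

theorem withDensity_norm_rotationInvariant {k : ℝ → ℝ≥0∞} (hk : Measurable k) (R : V ≃ₗᵢ[ℝ] V) :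
    ((volume : Measure V).withDensity fun x => k ‖x‖).map R =
      volume.withDensity fun x => k ‖x‖ := by
  ext A hA
  rw [Measure.map_apply R.continuous.measurable hA, withDensity_apply _ hA,
    withDensity_apply _ (R.continuous.measurable hA),
    ← R.measurePreserving.setLIntegral_comp_preimage hA (by fun_prop)]
  simp

end SphereAdd

section SumLaw

variable {n : ℕ}

local notation "𝔼" d => EuclideanSpace ℝ (Fin d)

instance (d : ℕ) : IsFiniteMeasure (surfaceMeasure d) :=
  inferInstanceAs (IsFiniteMeasure (Measure.toSphere _))

/-- The radial profile of `σ ∗ σ` on `ℝ^{n+2}`, up to the factor `ω_n`. -/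
noncomputable def sumProfile (n : ℕ) (r : ℝ) : ℝ :=
  (Set.Ioo (0 : ℝ) 2).indicator (fun r => r⁻¹ * (1 - r ^ 2 / 4) ^ (((n : ℝ) - 1) / 2)) r

theorem measurable_sumProfile (n : ℕ) : Measurable (sumProfile n) :=
  Measurable.indicator (by fun_prop) measurableSet_Ioo

theorem setLIntegral_Ioi_mul_sumProfile (φ : ℝ → ℝ≥0∞) :
    ∫⁻ r in Set.Ioi (0 : ℝ), ENNReal.ofReal (r ^ (n + 1) * sumProfile n r) * φ r =
      ∫⁻ r in Set.Ioo (0 : ℝ) 2,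
        ENNReal.ofReal (r ^ n * (1 - r ^ 2 / 4) ^ (((n : ℝ) - 1) / 2)) * φ r := by
  rw [← Set.inter_eq_left.2 (Set.Ioo_subset_Ioi_self : Set.Ioo (0 : ℝ) 2 ⊆ Set.Ioi 0),
    ← setLIntegral_indicator measurableSet_Ioo]
  refine lintegral_congr fun r => ?_
  by_cases hr : r ∈ Set.Ioo (0 : ℝ) 2
  · rw [sumProfile, Set.indicator_of_mem hr, Set.indicator_of_mem hr, pow_succ, mul_assoc,
      mul_inv_cancel_left₀ hr.1.ne']
  · simp [sumProfile, Set.indicator_of_notMem hr]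

theorem image_two_mul_cos_half :
    (fun θ => 2 * Real.cos (θ / 2)) '' Set.Ioo 0 Real.pi = Set.Ioo 0 2 := by
  ext r
  constructor
  · rintro ⟨θ, ⟨h0, hπ⟩, rfl⟩
    have hpos : 0 < Real.cos (θ / 2) := Real.cos_pos_of_mem_Ioo ⟨by linarith, by linarith⟩
    have hlt : Real.cos (θ / 2) < 1 := by
      rw [← Real.cos_zero]
      exact Real.cos_lt_cos_of_nonneg_of_le_pi le_rfl (by linarith) (by linarith)
    exact ⟨by simpa using hpos, by simp only; linarith⟩
  · rintro ⟨h0, h2⟩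
    have hpos := Real.arccos_pos.2 (by linarith : r / 2 < 1)
    have hlt := Real.arccos_lt_pi_div_two.2 (by linarith : 0 < r / 2)
    refine ⟨2 * Real.arccos (r / 2), ⟨by linarith, by linarith⟩, ?_⟩
    simp only [mul_div_cancel_left₀ _ (two_ne_zero' ℝ)]
    rw [Real.cos_arccos (by linarith) (by linarith)]
    ring

theorem injOn_two_mul_cos_half : Set.InjOn (fun θ => 2 * Real.cos (θ / 2)) (Set.Ioo 0 Real.pi) := by
  intro a ha b hb hab
  have := Real.injOn_cos (x₁ := a / 2) (x₂ := b / 2)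
    ⟨by linarith [ha.1], by linarith [ha.2, Real.pi_pos]⟩
    ⟨by linarith [hb.1], by linarith [hb.2, Real.pi_pos]⟩ (by simpa using hab)
  linarith

theorem hasDerivAt_two_mul_cos_half (θ : ℝ) :
    HasDerivAt (fun θ => 2 * Real.cos (θ / 2)) (-Real.sin (θ / 2)) θ :=
  (((hasDerivAt_id' θ).div_const 2).cos.const_mul 2).congr_deriv (by ring)

theorem lintegral_sin_pow_two_mul_cos_half (φ : ℝ → ℝ≥0∞) :
    ∫⁻ θ in Set.Ioo 0 Real.pi, ENNReal.ofReal (Real.sin θ ^ n) * φ (2 * Real.cos (θ / 2)) =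
      ∫⁻ r in Set.Ioo (0 : ℝ) 2,
        ENNReal.ofReal (r ^ n * (1 - r ^ 2 / 4) ^ (((n : ℝ) - 1) / 2)) * φ r := by
  rw [← image_two_mul_cos_half, lintegral_image_eq_lintegral_abs_deriv_mul measurableSet_Ioo
    (fun θ _ => (hasDerivAt_two_mul_cos_half θ).hasDerivWithinAt) injOn_two_mul_cos_half]
  refine setLIntegral_congr_fun measurableSet_Ioo fun θ hθ => ?_
  have hs : 0 < Real.sin (θ / 2) :=
    Real.sin_pos_of_pos_of_lt_pi (by linarith [hθ.1]) (by linarith [hθ.2, Real.pi_pos])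
  have hsin_sq : 1 - (2 * Real.cos (θ / 2)) ^ 2 / 4 = Real.sin (θ / 2) ^ (2 : ℝ) := by
    rw [Real.rpow_two, Real.sin_sq]
    ring
  have hdouble : Real.sin θ = 2 * Real.sin (θ / 2) * Real.cos (θ / 2) := by
    rw [← Real.sin_two_mul, mul_div_cancel₀ _ (two_ne_zero' ℝ)]
  rw [← mul_assoc, ← ENNReal.ofReal_mul (abs_nonneg _), abs_neg, abs_of_pos hs, hsin_sq,
    ← Real.rpow_mul hs.le, hdouble, show (2 : ℝ) * (((n : ℝ) - 1) / 2) = n - 1 by ring,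
    Real.rpow_sub_one hs.ne', Real.rpow_natCast]
  congr 2
  field_simp
  ring

theorem lintegral_norm_add_surfaceMeasure (η : USphere (n + 2)) {φ : ℝ → ℝ≥0∞}
    (hφ : Measurable φ) :
    ∫⁻ ζ : USphere (n + 2), φ ‖(η : 𝔼 (n + 2)) + ζ‖ ∂(surfaceMeasure (n + 2)) =
      sphereArea n *
        ∫⁻ r in Set.Ioi (0 : ℝ), ENNReal.ofReal (r ^ (n + 1) * sumProfile n r) * φ r := by
  let e : 𝔼 (n + 2) := EuclideanSpace.single 0 1
  obtain ⟨R, hR : R e = η⟩ := exists_linearIsometryEquiv_apply_eq (by simp [e] : ‖e‖ = ‖η.1‖)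
  have hnorm (ζ : USphere (n + 2)) :
      ‖(η : 𝔼 (n + 2)) + sphereHomeomorph R ζ‖ = √(2 + 2 * (ζ : 𝔼 (n + 2)) 0) := by
    rw [coe_sphereHomeomorph, ← hR, ← map_add, R.norm_map, ← Real.sqrt_sq (norm_nonneg _),
      norm_add_sq_real]
    simp only [PiLp.norm_single, norm_one, one_pow, EuclideanSpace.inner_single_left,
      Real.ringHom_apply, one_mul, norm_eq_of_mem_sphere, e]
    ring_nf
  rw [surfaceMeasure, ← (measurePreserving_sphereHomeomorph R).lintegral_comp (by fun_prop)]
  simp only [hnorm]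
  rw [← surfaceMeasure, lintegral_apply_zero_surfaceMeasure (φ := fun t => φ √(2 + 2 * t))
    (by fun_prop), setLIntegral_Ioi_mul_sumProfile, ← lintegral_sin_pow_two_mul_cos_half]
  congr 1
  refine setLIntegral_congr_fun measurableSet_Ioo fun θ hθ => ?_
  have hcos : 0 < Real.cos (θ / 2) :=
    Real.cos_pos_of_mem_Ioo ⟨by linarith [hθ.1, Real.pi_pos], by linarith [hθ.2]⟩
  have hhalf : 2 + 2 * Real.cos θ = (2 * Real.cos (θ / 2)) ^ 2 := by
    rw [mul_pow, Real.cos_sq, mul_div_cancel₀ _ (two_ne_zero' ℝ)]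
    ring
  simp only [hhalf, Real.sqrt_sq (by positivity : 0 ≤ 2 * Real.cos (θ / 2))]

/-- The density of `σ ∗ σ` with respect to Lebesgue measure on `ℝ^{n+2}`. -/
noncomputable def sumDensity (n : ℕ) (x : 𝔼 (n + 2)) : NNReal :=
  (sphereArea n).toNNReal * (sumProfile n ‖x‖).toNNReal

theorem measurable_sumDensity (n : ℕ) : Measurable (sumDensity n) := by
  have := measurable_sumProfile n
  unfold sumDensity
  fun_prop

theorem coe_sumDensity (x : 𝔼 (n + 2)) :
    (sumDensity n x : ℝ≥0∞) = sphereArea n * ENNReal.ofReal (sumProfile n ‖x‖) := by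
  have hfin : sphereArea n ≠ ∞ := measure_ne_top _ _
  rw [sumDensity, ENNReal.coe_mul, ENNReal.coe_toNNReal hfin, ENNReal.ofReal]

theorem map_norm_map_sphereAdd (n : ℕ) :
    (((surfaceMeasure (n + 2)).prod (surfaceMeasure (n + 2))).map sphereAdd).map norm =
      (volume.withDensity fun x : 𝔼 (n + 2) => (sumDensity n x : ℝ≥0∞)).map norm := by
  have hprofile := measurable_sumProfile n
  have hdensity := measurable_sumDensity n
  refine Measure.ext_of_lintegral _ fun φ hφ => ?_
  have hφnorm : Measurable fun x : 𝔼 (n + 2) => φ ‖x‖ := by fun_prop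
  rw [lintegral_map hφ measurable_norm, lintegral_map hφnorm measurable_sphereAdd,
    lintegral_map hφ measurable_norm,
    lintegral_withDensity_eq_lintegral_mul _ hdensity.coe_nnreal_ennreal hφnorm]
  simp only [Pi.mul_apply, coe_sumDensity]
  rw [lintegral_fun_norm_toSphere volume (f := fun r =>
      sphereArea n * ENNReal.ofReal (sumProfile n r) * φ r) (by fun_prop),
    lintegral_prod _ (by fun_prop [sphereAdd])]
  simp only [sphereAdd, lintegral_norm_add_surfaceMeasure _ hφ, lintegral_const]
  rw [surfaceMeasure, mul_comm, ← lintegral_const_mul _ (by fun_prop)]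
  congr 1
  refine setLIntegral_congr_fun measurableSet_Ioi fun r (hr : 0 < r) => ?_
  simp only [finrank_euclideanSpace, Fintype.card_fin, Nat.add_succ_sub_one]
  rw [ENNReal.ofReal_mul (by positivity)]
  ring

theorem map_sphereAdd (n : ℕ) :
    ((surfaceMeasure (n + 2)).prod (surfaceMeasure (n + 2))).map sphereAdd =
      volume.withDensity fun x : 𝔼 (n + 2) => (sumDensity n x : ℝ≥0∞) := by
  have hprofile := measurable_sumProfile n
  have hnorm := map_norm_map_sphereAdd n
  have hfin : IsFiniteMeasure (volume.withDensity fun x : 𝔼 (n + 2) => (sumDensity n x : ℝ≥0∞)) :=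
    ⟨by
      have hmass := congrArg (· Set.univ) hnorm
      simp only [Measure.map_apply measurable_norm MeasurableSet.univ, Set.preimage_univ] at hmass
      exact hmass ▸ measure_lt_top _ _⟩
  refine ext_of_rotationInvariant map_sphereAdd_rotationInvariant (fun R => ?_) hnorm
  simp only [coe_sumDensity]
  exact withDensity_norm_rotationInvariant
    (k := fun r => sphereArea n * ENNReal.ofReal (sumProfile n r)) (by fun_prop) R

end SumLaw

section BilinearInequality

variable {n d : ℕ}

local notation "𝔼" d => EuclideanSpace ℝ (Fin d)

theorem sumProfile_eq_weightKernel {p : USphere (n + 2) × USphere (n + 2)}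
    (hp : ‖sphereAdd p‖ ∈ Set.Ioo (0 : ℝ) 2) :
    ENNReal.ofReal (sumProfile n ‖sphereAdd p‖) =
      ENNReal.ofReal ((2 : ℝ) ^ ((2 - ((n + 2 : ℕ) : ℝ)) / 2)) * weightKernel (n + 2) p.1 p.2 := by
  rw [sumProfile, Set.indicator_of_mem hp, weightKernel]
  set t : ℝ := inner ℝ (p.1 : 𝔼 (n + 2)) (p.2 : 𝔼 (n + 2))
  have hsq : ‖sphereAdd p‖ ^ 2 = 2 * (1 + t) := by
    rw [sphereAdd, norm_add_sq_real]
    simp only [norm_eq_of_mem_sphere]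
    ring
  have hadd : 0 < 1 + t := by nlinarith [hp.1]
  have hsub : 0 < 1 - t := by nlinarith [hp.1, hp.2]
  have hr : ‖sphereAdd p‖ = (2 * (1 + t)) ^ (1 / 2 : ℝ) := by
    rw [← Real.sqrt_eq_rpow, ← hsq, Real.sqrt_sq (norm_nonneg _)]
  have hexp : (((n + 2 : ℕ) : ℝ) - 3) * (1 / 2) = ((n : ℝ) - 1) / 2 := by
    push_cast
    ring
  have hpow : (2 : ℝ) ^ ((2 - ((n + 2 : ℕ) : ℝ)) / 2) =
      ((2 : ℝ) ^ (1 / 2 : ℝ))⁻¹ * ((2 : ℝ) ^ (((n : ℝ) - 1) / 2))⁻¹ := by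
    rw [← Real.rpow_neg zero_le_two, ← Real.rpow_neg zero_le_two, ← Real.rpow_add zero_lt_two]
    congr 1
    push_cast
    ring
  rw [ENNReal.ofReal_rpow_of_pos hsub, ← ENNReal.ofReal_div_of_pos hadd,
    ENNReal.ofReal_rpow_of_pos (by positivity), ← ENNReal.ofReal_mul (by positivity)]
  congr 1
  rw [hsq, show 1 - 2 * (1 + t) / 4 = (1 - t) * 2⁻¹ by ring, hr,
    Real.mul_rpow zero_le_two hadd.le, Real.mul_rpow hsub.le (by norm_num),
    Real.div_rpow (by positivity) hadd.le, ← Real.rpow_mul hsub.le, Real.inv_rpow zero_le_two,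
    hexp, hpow, mul_inv]
  ring

theorem weightedSide_eq_lintegral_sumDensity (f₁ f₂ : USphere (n + 2) → ℂ) :
    weightedSide (n + 2) f₁ f₂ = ENNReal.ofReal ((2 * Real.pi) ^ Module.finrank ℝ (𝔼 (n + 2))) *
      ∫⁻ p, sumDensity n (sphereAdd p) * ‖f₁ p.1 * f₂ p.2‖ₑ ^ 2
        ∂((surfaceMeasure (n + 2)).prod (surfaceMeasure (n + 2))) := by
  have hfin : sphereArea n ≠ ∞ := measure_ne_top _ _
  rw [weightedSide, ENNReal.ofReal_mul (by positivity), finrank_euclideanSpace, Fintype.card_fin,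
    mul_assoc, mul_assoc, Nat.add_sub_cancel, ← lintegral_const_mul' _ _ hfin,
    ← lintegral_const_mul' _ _ ENNReal.ofReal_ne_top]
  congr 1
  refine lintegral_congr_ae ?_
  filter_upwards [ae_pos_comp measurable_sphereAdd (measurable_sumDensity n) (map_sphereAdd n)]
    with p hp
  have hmem : ‖sphereAdd p‖ ∈ Set.Ioo (0 : ℝ) 2 := by
    by_contra hnotMem
    simp [sumDensity, sumProfile, Set.indicator_of_notMem hnotMem] at hp
  rw [coe_sumDensity, sumProfile_eq_weightKernel hmem, enorm_mul, mul_pow]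
  ring

theorem bilinearExtensionNormSq_eq (f₁ f₂ : USphere d → ℂ) :
    bilinearExtensionNormSq d f₁ f₂ = eLpNorm (pushFourier
      ((surfaceMeasure d).prod (surfaceMeasure d)) sphereAdd fun p => f₁ p.1 * f₂ p.2)
      2 volume ^ 2 := by
  rw [bilinearExtensionNormSq]
  congr 2
  funext ξ
  rw [extensionFourier, extensionFourier, pushFourier, ← integral_prod_mul]
  refine integral_congr_ae (ae_of_all _ fun p => ?_)
  simp only [sphereAdd, inner_add_left, Complex.ofReal_add, mul_add, Complex.exp_add]
  ring

theorem bilinearExtensionNormSq_le_weightedSide (hd : 2 ≤ d) {f₁ f₂ : USphere d → ℂ}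
    (hf₁ : Integrable f₁ (surfaceMeasure d)) (hf₂ : Integrable f₂ (surfaceMeasure d)) :
    bilinearExtensionNormSq d f₁ f₂ ≤ weightedSide d f₁ f₂ := by
  obtain ⟨n, rfl⟩ := Nat.exists_eq_add_of_le' hd
  rw [bilinearExtensionNormSq_eq, weightedSide_eq_lintegral_sumDensity]
  exact eLpNorm_pushFourier_two_sq_le measurable_sphereAdd (measurable_sumDensity n)
    (map_sphereAdd n) (hf₁.mul_prod hf₂)

theorem bilinearExtensionNormSq_eq_weightedSide_iff (hd : 2 ≤ d) {f₁ f₂ : USphere d → ℂ}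
    (hf₁ : Integrable f₁ (surfaceMeasure d)) (hf₂ : Integrable f₂ (surfaceMeasure d))
    (hfin : weightedSide d f₁ f₂ < ∞) :
    bilinearExtensionNormSq d f₁ f₂ = weightedSide d f₁ f₂ ↔
      AEStronglyMeasurable[MeasurableSpace.comap sphereAdd inferInstance]
        (fun p => f₁ p.1 * f₂ p.2) ((surfaceMeasure d).prod (surfaceMeasure d)) := by
  obtain ⟨n, rfl⟩ := Nat.exists_eq_add_of_le' hd
  rw [bilinearExtensionNormSq_eq, weightedSide_eq_lintegral_sumDensity]
  rw [weightedSide_eq_lintegral_sumDensity] at hfin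
  exact eLpNorm_pushFourier_two_sq_eq_iff measurable_sphereAdd (measurable_sumDensity n)
    (map_sphereAdd n) (hf₁.mul_prod hf₂) (ENNReal.lt_top_of_mul_ne_top_right hfin.ne
      (ENNReal.ofReal_pos.2 (by positivity)).ne')

end BilinearInequality

section LinearAlgebra

variable {K E T : Type*} [Field K] [AddCommGroup E] [Module K E]

theorem mem_span_pair_of_not_linearIndependent {x u v : E} (huv : LinearIndependent K ![u, v])
    (h : ¬ LinearIndependent K ![x, u, v]) : x ∈ Submodule.span K {u, v} := by
  by_contra hx
  exact h (linearIndependent_finCons.2 ⟨huv, by simpa [Set.pair_comm] using hx⟩)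

theorem exists_not_mem_span_pair {w : Fin 3 → E} (hw : LinearIndependent K w) (x y : E) :
    ∃ i, w i ∉ Submodule.span K {x, y} := by
  classical
  by_contra! hmem
  have hle : Submodule.span K (Set.range w) ≤ Submodule.span K ({x, y} : Finset E) :=
    Submodule.span_le.2 <| Set.range_subset_iff.2 fun i => by simpa using hmem i
  have hrank := (Submodule.finrank_mono hle).trans
    ((finrank_span_finset_le_card _).trans Finset.card_le_two)
  simp [finrank_span_eq_card hw] at hrank

theorem exists_forall_sub_eq_smul {u c : Fin 3 → E} (hu : LinearIndependent K u)
    (hc : ∀ i j, ¬ LinearIndependent K ![c j - c i, u i, u j]) :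
    ∃ O : E, ∀ i, ∃ κ : K, c i - O = κ • u i := by
  have hpair : ∀ i j, i ≠ j → LinearIndependent K ![u i, u j] := fun i j hij => by
    have := hu.comp ![i, j] (injective_pair_iff_ne.2 hij)
    convert this using 1
    exact List.ofFn_injective rfl
  have hmem : ∀ i j, i ≠ j → ∃ α β : K, α • u i + β • u j = c j - c i := fun i j hij =>
    Submodule.mem_span_pair.1 <| mem_span_pair_of_not_linearIndependent (hpair i j hij) (hc i j)
  obtain ⟨α, β, h01⟩ := hmem 0 1 (by decide)
  obtain ⟨γ, δ, h02⟩ := hmem 0 2 (by decide)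
  obtain ⟨ε, η, h12⟩ := hmem 1 2 (by decide)
  have hrel := Fintype.linearIndependent_iff.1 hu ![α - γ, β + ε, η - δ] (by
    simp only [Fin.sum_univ_three, Matrix.cons_val]
    have : (c 1 - c 0) + (c 2 - c 1) - (c 2 - c 0) = 0 := by abel
    rw [← h01, ← h02, ← h12] at this
    rw [← this]
    module)
  have hα : α = γ := sub_eq_zero.1 (hrel 0)
  refine ⟨c 0 + α • u 0, fun i => ?_⟩
  match i with
  | 0 => exact ⟨-α, by simp⟩
  | 1 => exact ⟨β, by rw [← sub_sub, ← h01]; module⟩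
  | 2 => exact ⟨δ, by rw [← sub_sub, ← h02, hα]; module⟩

/-- The hypothesis `hU` says that any two of the lines `c t + K U t` are coplanar, and the
conclusion that all of them pass through `O`. -/
theorem exists_common_point {c U : T → E}
    (hU : ∀ s t, ¬ LinearIndependent K ![c t - c s, U s, U t]) {u : Fin 3 → T}
    (hu : LinearIndependent K (U ∘ u)) :
    ∃ O : E, ∀ s, ¬ LinearIndependent K ![c s - O, U s] := by
  obtain ⟨O, hO⟩ := exists_forall_sub_eq_smul (c := c ∘ u) hu fun i j => hU (u i) (u j)
  refine ⟨O, fun s hs => ?_⟩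
  obtain ⟨i, hi⟩ := exists_not_mem_span_pair hu (c s - O) (U s)
  obtain ⟨κ, hκ⟩ := hO i
  have hi3 : LinearIndependent K ![U (u i), c s - O, U s] :=
    linearIndependent_finCons.2 ⟨hs, by simpa [Set.pair_comm] using hi⟩
  refine hU s (u i) (Fintype.linearIndependent_iff.2 fun g hg => ?_)
  have hrel := Fintype.linearIndependent_iff.1 hi3 ![g 0 * κ + g 2, -g 0, g 1] (by
    simp only [Fin.sum_univ_three, Matrix.cons_val, Function.comp_apply] at hg hκ ⊢
    rw [← hg, eq_add_of_sub_eq hκ]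
    module)
  have h0 : g 0 = 0 := by simpa using hrel 1
  have h1 : g 1 = 0 := hrel 2
  have h2 : g 2 = 0 := by simpa [h0] using hrel 0
  simp [Fin.forall_fin_succ, h0, h1, h2]

theorem exists_linearIndependent_comp {n : ℕ} {U : T → Fin n → K}
    (hU : ∀ w : Fin n → K, (∀ t, ∑ i, w i * U t i = 0) → w = 0) :
    ∃ t : Fin n → T, LinearIndependent K (U ∘ t) := by
  have hspan : Submodule.span K (Set.range U) = ⊤ := by
    by_contra hne
    obtain ⟨φ, hφ, hker⟩ := Submodule.exists_le_ker_of_lt_top _ (lt_top_iff_ne_top.2 hne)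
    have hφU : ∀ x, φ x = ∑ i, φ (fun j => if i = j then 1 else 0) * x i := fun x => by
      simp only [φ.pi_apply_eq_sum_univ x, smul_eq_mul, mul_comm]
    have hzero := hU _ fun t => (hφU (U t)).symm.trans (hker (Submodule.subset_span ⟨t, rfl⟩))
    exact hφ (LinearMap.ext fun x => by simp [hφU x, fun i => congrFun hzero i])
  have hrank : Module.finrank K (Submodule.span K (Set.range U)) = n := by
    rw [hspan, finrank_top, Module.finrank_fin_fun]
  obtain ⟨v, hv, -, hli⟩ := Submodule.exists_fun_fin_finrank_span_eq K (Set.range U)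
  choose t ht using hv
  obtain rfl : v = U ∘ t := funext fun i => (ht i).symm
  exact ⟨t ∘ Fin.cast hrank.symm, hli.comp _ (Fin.cast_injective _)⟩

theorem linearIndependent_iff_exists_det_ne_zero {n : ℕ} {v : Fin n → T → K} :
    LinearIndependent K v ↔ ∃ t : Fin n → T, (Matrix.of fun i j => v i (t j)).det ≠ 0 := by
  have hdet (t : Fin n → T) : (Matrix.of fun i j => v i (t j)).det ≠ 0 ↔
      LinearIndependent K fun j i => v i (t j) := by
    rw [← isUnit_iff_ne_zero, ← Matrix.isUnit_iff_isUnit_det,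
      ← Matrix.linearIndependent_cols_iff_isUnit]
    rfl
  refine ⟨fun h => ?_, fun ⟨t, ht⟩ => Fintype.linearIndependent_iff.2 fun w hw => ?_⟩
  · obtain ⟨t, ht⟩ := exists_linearIndependent_comp (U := fun t i => v i t) fun w hw =>
      funext <| Fintype.linearIndependent_iff.1 h w <| funext fun t => by simpa using hw t
    exact ⟨t, (hdet t).2 ht⟩
  · refine congrFun (Matrix.eq_zero_of_vecMul_eq_zero ht (funext fun j => ?_))
    simpa [Matrix.vecMul, dotProduct] using congrFun hw (t j)

theorem linearIndependent_coeFn_iff {n : ℕ} {V : Type*} [NormedAddCommGroup V] [NormedSpace ℝ V]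
    {v : Fin n → V →L[ℝ] ℂ} : LinearIndependent ℂ (fun i => ⇑(v i)) ↔ LinearIndependent ℂ v := by
  simp only [Fintype.linearIndependent_iff, funext_iff, DFunLike.ext_iff, Finset.sum_apply,
    Pi.smul_apply, sum_apply, smul_apply, Pi.zero_apply, zero_apply]

end LinearAlgebra

section InfinitesimalRotation

variable {V : Type*} [NormedAddCommGroup V] [InnerProductSpace ℝ V] [FiniteDimensional ℝ V]
  {A : V →L[ℝ] V}

theorem exists_linearIsometryEquiv_hasDerivAt (hA : A ∈ skewAdjoint (V →L[ℝ] V)) :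
    ∃ R : ℝ → V ≃ₗᵢ[ℝ] V, (∀ x, R 0 x = x) ∧
      ∀ s x, HasDerivAt (fun u => R u x) (A (R s x)) s := by
  let +nondep : NormedAlgebra ℚ (V →L[ℝ] V) := .restrictScalars ℚ ℝ _
  have hexp (s : ℝ) : NormedSpace.exp (s • A) ∈ unitary (V →L[ℝ] V) :=
    NormedSpace.exp_mem_unitary_of_mem_skewAdjoint (skewAdjoint.smul_mem s hA)
  refine ⟨fun s => Unitary.linearIsometryEquiv ⟨_, hexp s⟩, fun x => ?_, fun s x => ?_⟩
  · change NormedSpace.exp ((0 : ℝ) • A) x = x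
    simp
  · exact (ContinuousLinearMap.apply ℝ V x).hasFDerivAt.comp_hasDerivAt s
      (hasDerivAt_exp_smul_const' A s)

variable [MeasurableSpace V] [BorelSpace V]

local notation "𝕊" => Metric.sphere (0 : V) 1
local notation "σ" => Measure.toSphere (volume : Measure V)

theorem integrable_toSphere_of_continuous {E : Type*} [NormedAddCommGroup E]
    {g : V → E} (hg : Continuous g) : Integrable (fun ζ : 𝕊 => g ζ) σ :=
  (hg.comp continuous_subtype_val).integrable_of_hasCompactSupport
    (HasCompactSupport.of_compactSpace _)

theorem integral_fderiv_toSphere_eq_zero {φ : V → ℂ} (hφ : ContDiff ℝ 1 φ)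
    (hA : A ∈ skewAdjoint (V →L[ℝ] V)) : ∫ ζ : 𝕊, fderiv ℝ φ ζ (A ζ) ∂σ = 0 := by
  obtain ⟨R, hR0, hR⟩ := exists_linearIsometryEquiv_hasDerivAt hA
  have hcont : Continuous fun x => fderiv ℝ φ x (A x) :=
    (hφ.continuous_fderiv one_ne_zero).clm_apply A.continuous
  obtain ⟨C, hC⟩ := (isCompact_sphere (0 : V) 1).exists_bound_of_continuousOn hcont.continuousOn
  have hderiv := (hasDerivAt_integral_of_dominated_loc_of_deriv_le (μ := σ) (x₀ := (0 : ℝ))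
    (F := fun s (ζ : 𝕊) => φ (R s ζ)) (F' := fun s ζ => fderiv ℝ φ (R s ζ) (A (R s ζ)))
    (bound := fun _ => C) Filter.univ_mem
    (.of_forall fun s =>
      (integrable_toSphere_of_continuous (hφ.continuous.comp (R s).continuous)).1)
    (integrable_toSphere_of_continuous (hφ.continuous.comp (R 0).continuous))
    (integrable_toSphere_of_continuous (hcont.comp (R 0).continuous)).1
    (.of_forall fun ζ s _ => hC _ (by simp)) (integrable_const C)
    (.of_forall fun ζ s _ => ((hφ.differentiable one_ne_zero _).hasFDerivAt.comp_hasDerivAt s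
      (hR s ζ)))).2
  have hconst (s : ℝ) : ∫ ζ : 𝕊, φ (R s ζ) ∂σ = ∫ ζ : 𝕊, φ ζ ∂σ :=
    integral_comp_sphereHomeomorph (R s) fun ζ => φ ζ
  simp only [hconst, hR0] at hderiv
  exact hderiv.unique (hasDerivAt_const _ _)

end InfinitesimalRotation

section Moment

variable {V : Type*} [NormedAddCommGroup V] [InnerProductSpace ℝ V]

/-- The real linear form `⟪x, ·⟫` as a complex-valued one. -/
noncomputable def innerForm (x : V) : V →L[ℝ] ℂ := Complex.ofRealCLM ∘L innerSL ℝ x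

@[simp]
theorem innerForm_apply (x v : V) : innerForm x v = (inner ℝ x v : ℝ) := rfl

@[fun_prop]
theorem continuous_innerForm : Continuous (innerForm (V := V)) := by
  unfold innerForm
  fun_prop

/-- The frequency at which `moment` has the kernel `e^{-i ζ·ξ}` of `pushFourier`. -/
noncomputable def imFreq (ξ : V) : V →L[ℝ] ℂ := -Complex.I • innerForm ξ

theorem imFreq_apply (ξ x : V) : imFreq ξ x = -Complex.I * (inner ℝ x ξ : ℝ) := by
  simp [imFreq, real_inner_comm]

variable [FiniteDimensional ℝ V] [MeasurableSpace V] [BorelSpace V]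

local notation "𝕊" => Metric.sphere (0 : V) 1
local notation "σ" => Measure.toSphere (volume : Measure V)

/-- The derivative of the Fourier–Laplace transform `μ ↦ ∫ f(ζ) e^{μ(ζ)} dσ(ζ)`, that is, the first
moment of `f e^μ σ`; a complex frequency is a real linear map `μ : V → ℂ`. -/
noncomputable def moment (f : 𝕊 → ℂ) (μ : V →L[ℝ] ℂ) : V →L[ℝ] ℂ :=
  ∫ ζ : 𝕊, (f ζ * Complex.exp (μ ζ)) • innerForm (ζ : V) ∂σ

theorem integrable_mul_continuous_sphere {f g : 𝕊 → ℂ} (hf : Integrable f σ)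
    (hg : Continuous g) : Integrable (fun ζ => f ζ * g ζ) σ := by
  obtain ⟨C, hC⟩ := isCompact_univ.exists_bound_of_continuousOn hg.continuousOn
  exact hf.mul_bdd hg.aestronglyMeasurable (ae_of_all _ fun ζ => hC ζ (Set.mem_univ _))

theorem moment_apply {f : 𝕊 → ℂ} (hf : Integrable f σ) (μ : V →L[ℝ] ℂ) (v : V) :
    moment f μ v = ∫ ζ : 𝕊, f ζ * Complex.exp (μ ζ) * (inner ℝ (ζ : V) v : ℝ) ∂σ := by
  have hfμ := integrable_mul_continuous_sphere hf (g := fun ζ => Complex.exp (μ ζ)) (by fun_prop)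
  obtain ⟨C, hC⟩ := isCompact_univ.exists_bound_of_continuousOn
    (f := fun ζ : 𝕊 => innerForm (ζ : V)) (by fun_prop)
  exact (ContinuousLinearMap.integral_apply (hfμ.smul_bdd C (by fun_prop)
    (ae_of_all _ fun ζ => hC ζ (Set.mem_univ _))) v).trans (by simp)

theorem moment_mul_exp (f : 𝕊 → ℂ) (μ O : V →L[ℝ] ℂ) :
    moment (fun ζ => f ζ * Complex.exp (O ζ)) μ = moment f (O + μ) := by
  simp only [moment, add_apply, Complex.exp_add, mul_assoc]

theorem moment_one_apply_mul (μ : V →L[ℝ] ℂ) (a b : V) :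
    moment 1 μ a * μ b = moment 1 μ b * μ a := by
  set A : V →L[ℝ] V := (innerSL ℝ a).smulRight b - (innerSL ℝ b).smulRight a
  have hA : A ∈ skewAdjoint (V →L[ℝ] V) := by
    rw [skewAdjoint.mem_iff, ContinuousLinearMap.star_eq_adjoint, eq_comm,
      ContinuousLinearMap.eq_adjoint_iff]
    intro x y
    simp only [neg_sub, sub_apply, ContinuousLinearMap.smulRight_apply, coe_innerSL_apply,
      inner_sub_left, inner_smul_left, Real.ringHom_apply, inner_sub_right, inner_smul_right,
      real_inner_comm, A]
    ring
  have hderiv (ζ : 𝕊) : fderiv ℝ (fun x => Complex.exp (μ x)) ζ (A ζ) =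
      Complex.exp (μ ζ) * (inner ℝ (ζ : V) a : ℝ) * μ b -
        Complex.exp (μ ζ) * (inner ℝ (ζ : V) b : ℝ) * μ a := by
    rw [(μ.hasFDerivAt.cexp).fderiv]
    simp only [sub_apply, ContinuousLinearMap.smulRight_apply, coe_innerSL_apply, smul_apply,
      map_sub, map_smul, Complex.real_smul, smul_eq_mul, real_inner_comm, A]
    ring
  have hint (v : V) : Integrable
      (fun ζ : 𝕊 => Complex.exp (μ ζ) * (inner ℝ (ζ : V) v : ℝ)) σ :=
    integrable_toSphere_of_continuous (g := fun x => Complex.exp (μ x) * (inner ℝ x v : ℝ))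
      (by fun_prop)
  have hzero := integral_fderiv_toSphere_eq_zero (μ.contDiff.cexp (n := 1)) hA
  simp only [hderiv] at hzero
  rw [integral_sub ((hint a).mul_const _) ((hint b).mul_const _), integral_mul_const,
    integral_mul_const] at hzero
  simpa [moment_apply (integrable_const (1 : ℂ)), Pi.one_def] using sub_eq_zero.1 hzero

end Moment

section FunctionalEquation

variable {V : Type*} [NormedAddCommGroup V] [InnerProductSpace ℝ V]

local notation "𝕊" => Metric.sphere (0 : V) 1
local notation "σ" => Measure.toSphere (volume : Measure V)

/-- The test function which detects dependence on the sum of the variables: it multiplies the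
frequencies `μ`, `ν` by a minor of `ν - μ`, `ζ₁`, `ζ₂`, so that its Fourier transform along
`sphereAdd` vanishes. -/
noncomputable def minorTest (μ ν : V →L[ℝ] ℂ) (e : Fin 3 → V) (p : 𝕊 × 𝕊) : ℂ :=
  Complex.exp (μ p.1) * Complex.exp (ν p.2) *
    (Matrix.of fun i j => ![ν - μ, innerForm (p.1 : V), innerForm (p.2 : V)] i (e j)).det

theorem minorTest_eq_sum (μ ν : V →L[ℝ] ℂ) (e : Fin 3 → V) (p : 𝕊 × 𝕊) :
    minorTest μ ν e p = ∑ τ : Equiv.Perm (Fin 3), (Equiv.Perm.sign τ : ℂ) * (ν - μ) (e (τ 0)) *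
      ((Complex.exp (μ p.1) * (inner ℝ (p.1 : V) (e (τ 1)) : ℝ)) *
        (Complex.exp (ν p.2) * (inner ℝ (p.2 : V) (e (τ 2)) : ℝ))) := by
  rw [minorTest, ← Matrix.det_transpose, Matrix.det_apply', Finset.mul_sum]
  refine Finset.sum_congr rfl fun τ _ => ?_
  simp only [Fin.prod_univ_three, Matrix.transpose_apply, Matrix.of_apply, Matrix.cons_val,
    innerForm_apply]
  ring

theorem continuous_minorTest (μ ν : V →L[ℝ] ℂ) (e : Fin 3 → V) : Continuous (minorTest μ ν e) := by
  simp only [funext (minorTest_eq_sum μ ν e)]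
  fun_prop

theorem minorTest_add_imFreq (μ ν : V →L[ℝ] ℂ) (e : Fin 3 → V) (ξ : V) (p : 𝕊 × 𝕊) :
    minorTest (μ + imFreq ξ) (ν + imFreq ξ) e p =
      Complex.exp (-Complex.I * (inner ℝ (sphereAdd p) ξ : ℝ)) * minorTest μ ν e p := by
  simp only [minorTest, add_apply, imFreq_apply, add_sub_add_right_eq_sub, sphereAdd,
    inner_add_left, Complex.ofReal_add, mul_add, Complex.exp_add]
  ring

variable [FiniteDimensional ℝ V] [MeasurableSpace V] [BorelSpace V]

theorem integral_mul_minorTest {f₁ f₂ : 𝕊 → ℂ} (hf₁ : Integrable f₁ σ) (hf₂ : Integrable f₂ σ)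
    (μ ν : V →L[ℝ] ℂ) (e : Fin 3 → V) :
    ∫ p, f₁ p.1 * f₂ p.2 * minorTest μ ν e p ∂Measure.prod σ σ =
      (Matrix.of fun i j => ![ν - μ, moment f₁ μ, moment f₂ ν] i (e j)).det := by
  have hint {f : 𝕊 → ℂ} (hf : Integrable f σ) (μ : V →L[ℝ] ℂ) (v : V) :
      Integrable (fun ζ : 𝕊 => f ζ * (Complex.exp (μ ζ) * (inner ℝ (ζ : V) v : ℝ))) σ :=
    integrable_mul_continuous_sphere hf (by fun_prop)
  rw [← Matrix.det_transpose, Matrix.det_apply']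
  simp only [minorTest_eq_sum, Finset.mul_sum, Fin.prod_univ_three, Matrix.transpose_apply,
    Matrix.of_apply, Matrix.cons_val, moment_apply hf₁, moment_apply hf₂, mul_assoc]
  rw [integral_finsetSum]
  · refine Finset.sum_congr rfl fun τ _ => ?_
    rw [← integral_prod_mul, ← integral_const_mul, ← integral_const_mul]
    refine integral_congr_ae (ae_of_all _ fun p => ?_)
    ring
  · refine fun τ _ => (((hint hf₁ μ (e (τ 1))).mul_prod (hint hf₂ ν (e (τ 2)))).const_mul
      ((Equiv.Perm.sign τ : ℂ) * (ν - μ) (e (τ 0)))).congr (ae_of_all _ fun p => ?_)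
    ring

theorem integral_minorTest (μ ν : V →L[ℝ] ℂ) (e : Fin 3 → V) :
    ∫ p, minorTest μ ν e p ∂Measure.prod σ σ = 0 := by
  have h := integral_mul_minorTest (f₁ := (1 : 𝕊 → ℂ)) (f₂ := 1) (integrable_const (1 : ℂ))
    (integrable_const (1 : ℂ)) μ ν e
  simp only [Pi.one_apply, one_mul] at h
  rw [h, Matrix.det_fin_three]
  simp only [Matrix.of_apply, Matrix.cons_val, sub_apply]
  have hμ := moment_one_apply_mul μ
  have hν := moment_one_apply_mul ν
  generalize moment 1 μ = x at *
  generalize moment 1 ν = y at *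
  linear_combination x (e 0) * hν (e 1) (e 2) - x (e 1) * hν (e 0) (e 2) +
    x (e 2) * hν (e 0) (e 1) + y (e 0) * hμ (e 1) (e 2) - y (e 1) * hμ (e 0) (e 2) +
    y (e 2) * hμ (e 0) (e 1)

theorem not_linearIndependent_of_aestronglyMeasurable_sphereAdd {f₁ f₂ : 𝕊 → ℂ}
    (hf₁ : Integrable f₁ σ) (hf₂ : Integrable f₂ σ)
    (hsum : AEStronglyMeasurable[MeasurableSpace.comap sphereAdd inferInstance]
      (fun p : 𝕊 × 𝕊 => f₁ p.1 * f₂ p.2) (Measure.prod σ σ)) (μ ν : V →L[ℝ] ℂ) :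
    ¬ LinearIndependent ℂ ![ν - μ, moment f₁ μ, moment f₂ ν] := by
  rw [← linearIndependent_coeFn_iff, linearIndependent_iff_exists_det_ne_zero]
  rintro ⟨e, he⟩
  refine he ?_
  have hcont := continuous_minorTest μ ν e
  obtain ⟨C, hC⟩ := isCompact_univ.exists_bound_of_continuousOn hcont.continuousOn
  have hbound : ∀ᵐ p ∂Measure.prod σ σ, ‖minorTest μ ν e p‖ ≤ C :=
    ae_of_all _ fun p => hC p (Set.mem_univ _)
  have hfourier : pushFourier (Measure.prod σ σ) sphereAdd (minorTest μ ν e) = 0 :=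
    funext fun ξ => by
      simp only [pushFourier, ← minorTest_add_imFreq, integral_minorTest, Pi.zero_apply]
  rw [← integral_mul_minorTest hf₁ hf₂]
  exact integral_mul_eq_zero_of_pushFourier_eq_zero measurable_sphereAdd
    (.of_bound hcont.aestronglyMeasurable C hbound) hfourier hsum
    ((hf₁.mul_prod hf₂).mul_bdd hcont.aestronglyMeasurable hbound)

theorem exists_ae_eq_const_mul {f₁ f₂ : 𝕊 → ℂ}
    (hsum : AEStronglyMeasurable[MeasurableSpace.comap sphereAdd inferInstance]
      (fun p : 𝕊 × 𝕊 => f₁ p.1 * f₂ p.2) (Measure.prod σ σ)) (hf₁ : ¬ f₁ =ᵐ[σ] 0) :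
    ∃ κ : ℂ, f₂ =ᵐ[σ] fun ζ => κ * f₁ ζ := by
  obtain ⟨K, hK, hfK⟩ := hsum
  obtain ⟨F, -, rfl⟩ := hK.exists_eq_measurable_comp
  have hsymm : ∀ᵐ p ∂Measure.prod σ σ, f₁ p.1 * f₂ p.2 = f₁ p.2 * f₂ p.1 := by
    filter_upwards [hfK, Measure.measurePreserving_swap.quasiMeasurePreserving.ae hfK]
      with p hp hswap
    rw [hp]
    simpa [sphereAdd, add_comm] using hswap.symm
  obtain ⟨ζ, hζ, hae⟩ := ((Filter.not_eventually.1 hf₁).and_eventually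
    (Measure.ae_ae_of_ae_prod hsymm)).exists
  simp only [Pi.zero_apply] at hζ
  refine ⟨f₂ ζ / f₁ ζ, hae.mono fun η hη => ?_⟩
  field_simp
  linear_combination hη

end FunctionalEquation

section RadialFunction

variable {E F G : Type*} [NormedAddCommGroup E] [InnerProductSpace ℝ E]
  [NormedAddCommGroup F] [InnerProductSpace ℝ F] [NormedAddCommGroup G] [NormedSpace ℝ G]

theorem inner_fderiv_eq_zero_of_norm_eventually_eq {N : E → F} {x : E} {r : ℝ}
    (hN : DifferentiableAt ℝ N x) (hr : ∀ᶠ y in nhds x, ‖N y‖ = r) (v : E) :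
    inner ℝ (N x) (fderiv ℝ N x v) = 0 := by
  have hderiv := hN.hasFDerivAt.norm_sq.unique ((hasFDerivAt_const (r ^ 2) x).congr_of_eventuallyEq
    (hr.mono fun y hy => by simp only [hy]))
  simpa using congrArg (fun L => L v) hderiv

theorem eq_of_norm_eq_of_fderiv_tangential (hdim : 1 < Module.rank ℝ E) {Γ : E → G}
    (hΓ : Differentiable ℝ Γ) (htan : ∀ x v : E, x ≠ 0 → inner ℝ x v = 0 → fderiv ℝ Γ x v = 0)
    {x y : E} (hxy : ‖x‖ = ‖y‖) : Γ x = Γ y := by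
  rcases eq_or_ne x 0 with rfl | hx
  · rw [norm_zero, eq_comm, norm_eq_zero] at hxy
    rw [hxy]
  have hy : y ≠ 0 := norm_ne_zero_iff.1 (hxy ▸ norm_ne_zero_iff.2 hx)
  set N : E → E := fun z => (‖x‖ * ‖z‖⁻¹) • z
  have hN (z : E) (hz : z ≠ 0) : DifferentiableAt ℝ N z :=
    ((((contDiffAt_norm ℝ hz).differentiableAt (n := 1) one_ne_zero).inv
      (norm_ne_zero_iff.2 hz)).const_mul ‖x‖).smul differentiableAt_id
  have hnorm (z : E) (hz : z ≠ 0) : ‖N z‖ = ‖x‖ := by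
    rw [norm_smul, norm_mul, norm_inv, norm_norm, norm_norm,
      inv_mul_cancel_right₀ (norm_ne_zero_iff.2 hz)]
  have hfderiv (z : E) (hz : z ≠ 0) : fderiv ℝ (Γ ∘ N) z = 0 := by
    rw [fderiv_comp z (hΓ (N z)) (hN z hz)]
    refine ContinuousLinearMap.ext fun v => htan _ _ ?_ ?_
    · rw [← norm_ne_zero_iff, hnorm z hz]
      exact norm_ne_zero_iff.2 hx
    · exact inner_fderiv_eq_zero_of_norm_eventually_eq (hN z hz)
        (Filter.eventually_of_mem (isOpen_compl_singleton.mem_nhds hz) hnorm) v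
  have hconst := isOpen_compl_singleton.is_const_of_fderiv_eq_zero (𝕜 := ℝ)
    (isConnected_compl_singleton_of_one_lt_rank hdim 0).isPreconnected
    (fun z hz => ((hΓ (N z)).comp z (hN z hz)).differentiableWithinAt) hfderiv hx hy
  simpa [N, hx, hy, hxy] using hconst

end RadialFunction

section Rigidity

variable {V : Type*} [NormedAddCommGroup V] [InnerProductSpace ℝ V] [FiniteDimensional ℝ V]
  [MeasurableSpace V] [BorelSpace V]

local notation "𝕊" => Metric.sphere (0 : V) 1
local notation "σ" => Measure.toSphere (volume : Measure V)

theorem hasFDerivAt_pushFourier_toSphere {g : 𝕊 → ℂ} (hg : Integrable g σ) (ξ : V) :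
    HasFDerivAt (pushFourier σ (↑) g) (-Complex.I • moment g (imFreq ξ)) ξ := by
  have hker (ξ : V) (ζ : 𝕊) : ‖g ζ * Complex.exp (imFreq ξ ζ)‖ = ‖g ζ‖ := by
    rw [norm_mul, imFreq_apply, norm_exp_neg_I_mul, mul_one]
  have hnorm (ζ : 𝕊) : ‖innerForm (ζ : V)‖ ≤ 1 :=
    ContinuousLinearMap.opNorm_le_bound _ zero_le_one fun v => by
      simpa using norm_inner_le_norm (𝕜 := ℝ) (ζ : V) v
  have hderiv (ζ : 𝕊) (ξ : V) : HasFDerivAt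
      (fun ξ => Complex.exp (-Complex.I * (inner ℝ (ζ : V) ξ : ℝ)) * g ζ)
      (-Complex.I • (g ζ * Complex.exp (imFreq ξ ζ)) • innerForm (ζ : V)) ξ := by
    refine ((((innerForm (ζ : V)).hasFDerivAt.const_mul (-Complex.I)).cexp.mul_const
      (g ζ))).congr_fderiv ?_
    rw [imFreq_apply, innerForm_apply]
    module
  rw [moment, ← integral_smul]
  refine hasFDerivAt_integral_of_dominated_of_fderiv_le (bound := fun ζ => ‖g ζ‖)
    Filter.univ_mem (Filter.Eventually.of_forall fun ξ => ?_)
    (integrable_exp_mul measurable_subtype_coe hg ξ) ?_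
    (ae_of_all _ fun ζ ξ _ => ?_) hg.norm (ae_of_all _ fun ζ ξ _ => hderiv ζ ξ)
  · exact (integrable_exp_mul measurable_subtype_coe hg ξ).aestronglyMeasurable
  · have hexp : Continuous fun ζ : 𝕊 => Complex.exp (imFreq ξ ζ) := by fun_prop
    have hinner : Continuous fun ζ : 𝕊 => innerForm (ζ : V) := by fun_prop
    exact ((hg.aestronglyMeasurable.mul hexp.aestronglyMeasurable).smul
      hinner.aestronglyMeasurable).const_smul (-Complex.I)
  · rw [norm_smul, norm_smul, hker, norm_neg, Complex.norm_I, one_mul]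
    exact mul_le_of_le_one_right (norm_nonneg _) (hnorm ζ)

theorem ae_eq_const_of_moment_tangential (hdim : 2 ≤ Module.finrank ℝ V) {g : 𝕊 → ℂ}
    (hg : Integrable g σ)
    (htan : ∀ ξ v : V, ξ ≠ 0 → inner ℝ ξ v = 0 → moment g (imFreq ξ) v = 0) :
    ∃ c : ℂ, g =ᵐ[σ] fun _ => c := by
  have hrank : 1 < Module.rank ℝ V := by
    rw [← Module.finrank_eq_rank]
    exact_mod_cast hdim
  have : Nontrivial V := Module.nontrivial_of_finrank_pos (R := ℝ) (by omega)
  have hderiv := hasFDerivAt_pushFourier_toSphere hg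
  refine ae_eq_const_of_pushFourier_radial hg fun ξ η h =>
    eq_of_norm_eq_of_fderiv_tangential hrank (fun ξ => (hderiv ξ).differentiableAt)
      (fun ξ v hξ hv => ?_) h
  rw [(hderiv ξ).fderiv, smul_apply, htan ξ v hξ hv, smul_zero]

open Pointwise in
theorem toSphere_preimage_submodule {S : Submodule ℝ V} (hS : S ≠ ⊤) :
    σ (((↑) : 𝕊 → V) ⁻¹' S) = 0 := by
  rw [Measure.toSphere_apply' _
    (measurable_subtype_coe S.closed_of_finiteDimensional.measurableSet)]
  refine mul_eq_zero_of_right _ (measure_mono_null ?_ (Measure.addHaar_submodule volume S hS))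
  rintro _ ⟨r, -, _, ⟨ζ, hζ, rfl⟩, rfl⟩
  exact S.smul_mem r hζ

theorem ae_apply_ne_zero {L : V →L[ℝ] ℂ} (hL : L ≠ 0) : ∀ᵐ ζ : 𝕊 ∂σ, L ζ ≠ 0 := by
  refine measure_mono_null (fun ζ hζ => ?_) (toSphere_preimage_submodule (S := L.ker) fun h => ?_)
  · simpa using hζ
  · exact hL (ContinuousLinearMap.coe_injective (LinearMap.ker_eq_top.1 h))

theorem eq_zero_of_forall_moment {ι : Type*} [Fintype ι] {f : 𝕊 → ℂ} (hf : Integrable f σ)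
    (hf0 : ¬ f =ᵐ[σ] 0) {e : ι → V} {w : ι → ℂ}
    (hw : ∀ μ : V →L[ℝ] ℂ, ∑ i, w i * moment f μ (e i) = 0) :
    ∑ i, w i • innerForm (e i) = 0 := by
  set L : V →L[ℝ] ℂ := ∑ i, w i • innerForm (e i)
  have hfourier : pushFourier σ ((↑) : 𝕊 → V) (fun ζ => f ζ * L ζ) = 0 := funext fun ξ => by
    refine Eq.trans ?_ (hw (imFreq ξ))
    simp only [moment_apply hf, ← integral_const_mul]
    rw [← integral_finsetSum _ fun i _ => ?_]
    · refine integral_congr_ae (ae_of_all _ fun ζ => ?_)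
      simp only [L, sum_apply, smul_apply, smul_eq_mul, innerForm_apply, imFreq_apply,
        Finset.mul_sum, real_inner_comm (ζ : V)]
      exact Finset.sum_congr rfl fun i _ => by ring
    · simp only [mul_assoc]
      exact (integrable_mul_continuous_sphere hf (by fun_prop)).const_mul _
  have hzero := ae_eq_zero_of_pushFourier_eq_zero
    (.subtype_coe Metric.isClosed_sphere.measurableSet)
    (integrable_mul_continuous_sphere hf (by fun_prop)) hfourier
  by_contra hL
  exact hf0 <| by
    filter_upwards [hzero, ae_apply_ne_zero hL] with ζ hζ hLζ
    exact (mul_eq_zero.1 hζ).resolve_right hLζ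

theorem exists_linearIndependent_moment {n : ℕ} (hn : n ≤ Module.finrank ℝ V) {f : 𝕊 → ℂ}
    (hf : Integrable f σ) (hf0 : ¬ f =ᵐ[σ] 0) :
    ∃ μ : Fin n → V →L[ℝ] ℂ, LinearIndependent ℂ (moment f ∘ μ) := by
  have he := (stdOrthonormalBasis ℝ V).orthonormal.comp _ (Fin.castLE_injective hn)
  set e : Fin n → V := stdOrthonormalBasis ℝ V ∘ Fin.castLE hn
  obtain ⟨μ, hμ⟩ := exists_linearIndependent_comp (U := fun μ i => moment f μ (e i))
    fun w hw => funext fun j => by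
      have hzero := congrArg (fun L : V →L[ℝ] ℂ => L (e j)) (eq_zero_of_forall_moment hf hf0 hw)
      simpa [orthonormal_iff_ite.1 he, apply_ite Complex.ofReal] using hzero
  refine ⟨μ, Fintype.linearIndependent_iff.2 fun w hw =>
    Fintype.linearIndependent_iff.1 hμ w (funext fun j => ?_)⟩
  simpa using congrArg (fun L : V →L[ℝ] ℂ => L (e j)) hw

theorem ae_eq_const_mul_exp_of_aestronglyMeasurable_sphereAdd (hdim : 3 ≤ Module.finrank ℝ V)
    {f : 𝕊 → ℂ} (hf : Integrable f σ) (hf0 : ¬ f =ᵐ[σ] 0)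
    (hsum : AEStronglyMeasurable[MeasurableSpace.comap sphereAdd inferInstance]
      (fun p : 𝕊 × 𝕊 => f p.1 * f p.2) (Measure.prod σ σ)) :
    ∃ (c : ℂ) (ν : V →L[ℝ] ℂ), f =ᵐ[σ] fun ζ => c * Complex.exp (ν ζ) := by
  obtain ⟨μ, hμ⟩ := exists_linearIndependent_moment hdim hf hf0
  obtain ⟨O, hO⟩ := exists_common_point (c := id)
    (not_linearIndependent_of_aestronglyMeasurable_sphereAdd hf hf hsum) hμ
  obtain ⟨c, hc⟩ := ae_eq_const_of_moment_tangential (by omega)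
    (g := fun ζ : 𝕊 => f ζ * Complex.exp (O ζ))
    (integrable_mul_continuous_sphere hf (by fun_prop)) fun ξ v hξ hv => by
      have hξ0 : imFreq ξ ≠ 0 := fun h => by
        simpa [imFreq_apply, hξ] using congrArg (fun L : V →L[ℝ] ℂ => L ξ) h
      have hdep := hO (O + imFreq ξ)
      rw [id, add_sub_cancel_left, LinearIndependent.pair_iff' hξ0] at hdep
      obtain ⟨κ, hκ⟩ := not_forall_not.1 hdep
      rw [moment_mul_exp, ← hκ]
      simp [imFreq_apply, real_inner_comm, hv]
  refine ⟨c, -O, hc.mono fun ζ hζ => ?_⟩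
  simp only [← hζ, neg_apply, mul_assoc, ← Complex.exp_add, add_neg_cancel, Complex.exp_zero,
    mul_one]

theorem aestronglyMeasurable_sphereAdd_of_ae_eq_exp {f₁ f₂ : 𝕊 → ℂ} {c₁ c₂ : ℂ} {ν : V →L[ℝ] ℂ}
    (h₁ : f₁ =ᵐ[σ] fun ζ => c₁ * Complex.exp (ν ζ))
    (h₂ : f₂ =ᵐ[σ] fun ζ => c₂ * Complex.exp (ν ζ)) :
    AEStronglyMeasurable[MeasurableSpace.comap sphereAdd inferInstance]
      (fun p : 𝕊 × 𝕊 => f₁ p.1 * f₂ p.2) (Measure.prod σ σ) := by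
  refine ⟨fun p => c₁ * c₂ * Complex.exp (ν (sphereAdd p)),
    ((by fun_prop : Measurable fun x : V => c₁ * c₂ * Complex.exp (ν x)).comp
      (comap_measurable sphereAdd)).stronglyMeasurable, ?_⟩
  filter_upwards [Measure.quasiMeasurePreserving_fst.ae h₁,
    Measure.quasiMeasurePreserving_snd.ae h₂] with p h₁ h₂
  rw [h₁, h₂, sphereAdd, map_add, Complex.exp_add]
  ring

theorem aestronglyMeasurable_sphereAdd_iff (hdim : 3 ≤ Module.finrank ℝ V) {f₁ f₂ : 𝕊 → ℂ}
    (hf₁ : Integrable f₁ σ) (hf₁0 : ¬ f₁ =ᵐ[σ] 0) (hf₂0 : ¬ f₂ =ᵐ[σ] 0) :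
    AEStronglyMeasurable[MeasurableSpace.comap sphereAdd inferInstance]
        (fun p : 𝕊 × 𝕊 => f₁ p.1 * f₂ p.2) (Measure.prod σ σ) ↔
      ∃ (c₁ c₂ : ℂ) (ν : V →L[ℝ] ℂ), c₁ ≠ 0 ∧ c₂ ≠ 0 ∧
        (f₁ =ᵐ[σ] fun ζ => c₁ * Complex.exp (ν ζ)) ∧
        (f₂ =ᵐ[σ] fun ζ => c₂ * Complex.exp (ν ζ)) := by
  refine ⟨fun hsum => ?_, fun ⟨_, _, _, _, _, h₁, h₂⟩ =>
    aestronglyMeasurable_sphereAdd_of_ae_eq_exp h₁ h₂⟩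
  have hne {f : 𝕊 → ℂ} (hf : ¬ f =ᵐ[σ] 0) {c : ℂ} {h : 𝕊 → ℂ}
      (hc : f =ᵐ[σ] fun ζ => c * h ζ) : c ≠ 0 := by
    rintro rfl
    exact hf (hc.mono fun ζ hζ => by simpa using hζ)
  obtain ⟨κ, hκ⟩ := exists_ae_eq_const_mul hsum hf₁0
  have hsum₁ : AEStronglyMeasurable[MeasurableSpace.comap sphereAdd inferInstance]
      (fun p : 𝕊 × 𝕊 => f₁ p.1 * f₁ p.2) (Measure.prod σ σ) := by
    refine (hsum.const_mul κ⁻¹).congr ?_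
    filter_upwards [Measure.quasiMeasurePreserving_snd.ae hκ] with p hp
    rw [hp, mul_left_comm, inv_mul_cancel_left₀ (hne hf₂0 hκ)]
  obtain ⟨c, ν, hc⟩ :=
    ae_eq_const_mul_exp_of_aestronglyMeasurable_sphereAdd hdim hf₁ hf₁0 hsum₁
  have hc₂ : f₂ =ᵐ[σ] fun ζ => κ * c * Complex.exp (ν ζ) := by
    filter_upwards [hκ, hc] with ζ hκζ hcζ
    rw [hκζ, hcζ, mul_assoc]
  exact ⟨c, κ * c, ν, hne hf₁0 hc, hne hf₂0 hc₂, hc, hc₂⟩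

end Rigidity

section Coordinates

variable {n : ℕ}

/-- The frequency `x ↦ ∑ i, ν i * x i` with coordinates `ν`. -/
noncomputable def coordForm (ν : Fin n → ℂ) : EuclideanSpace ℝ (Fin n) →L[ℝ] ℂ :=
  ∑ i, ν i • Complex.ofRealCLM ∘L EuclideanSpace.proj i

theorem coordForm_apply (ν : Fin n → ℂ) (x : EuclideanSpace ℝ (Fin n)) :
    coordForm ν x = ∑ i, ν i * ((x i : ℝ) : ℂ) := by
  simp [coordForm]

theorem coordForm_surjective : Function.Surjective (coordForm (n := n)) := fun L =>
  ⟨fun i => L (EuclideanSpace.basisFun (Fin n) ℝ i), ContinuousLinearMap.ext fun x => by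
    conv_rhs => rw [← (EuclideanSpace.basisFun (Fin n) ℝ).sum_repr x]
    simp [coordForm_apply, mul_comm]⟩

end Coordinates

theorem corollary3 (d : ℕ) (hd : 2 ≤ d) (f₁ f₂ : USphere d → ℂ)
    (hf₁ : Integrable f₁ (surfaceMeasure d)) (hf₂ : Integrable f₂ (surfaceMeasure d))
    (hf₁0 : ¬ f₁ =ᵐ[surfaceMeasure d] 0) (hf₂0 : ¬ f₂ =ᵐ[surfaceMeasure d] 0) :
    bilinearExtensionNormSq d f₁ f₂ ≤ weightedSide d f₁ f₂ ∧
    (3 ≤ d → weightedSide d f₁ f₂ < ∞ →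
      (bilinearExtensionNormSq d f₁ f₂ = weightedSide d f₁ f₂ ↔
        ∃ (c₁ c₂ : ℂ) (ν : Fin d → ℂ), c₁ ≠ 0 ∧ c₂ ≠ 0 ∧
          (∀ᵐ ζ ∂(surfaceMeasure d), f₁ ζ =
            c₁ * Complex.exp (∑ i, ν i * (((ζ : EuclideanSpace ℝ (Fin d)) i : ℝ) : ℂ))) ∧
          (∀ᵐ ζ ∂(surfaceMeasure d), f₂ ζ =
            c₂ * Complex.exp (∑ i, ν i * (((ζ : EuclideanSpace ℝ (Fin d)) i : ℝ) : ℂ))))) := by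
  refine ⟨bilinearExtensionNormSq_le_weightedSide hd hf₁ hf₂, fun hd3 hfin => ?_⟩
  rw [bilinearExtensionNormSq_eq_weightedSide_iff hd hf₁ hf₂ hfin]
  have hiff := aestronglyMeasurable_sphereAdd_iff (by simpa using hd3) hf₁ hf₁0 hf₂0
  simp only [coordForm_surjective.exists, coordForm_apply] at hiff
  exact hiff
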